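/- **Definitions.** All manifolds are real and finite-dimensional. A *Lie loop* is an analytic manifold $B$ with an analytic product $m(a,b)=ab$ and a neutral element $\varepsilon$ such that the equations $ab=c$ and $ba=c$ have unique solutions $b$, depending analytically on $(a,c)$; it is *right mono-alternative* if $(ab^k)b^l=ab^{k+l}$ for all $k,l\in\mathbb Z$ and all $a,b$ near $\varepsilon$. Let $\lambda_a$ denote the left translation $b\mapsto ab$. A *quasi-Poisson Lie quasigroup* $(B,m,G,\sigma,P,\alpha,\chi,\langle\cdot,\cdot\rangle)$ consists of a right mono-alternative Lie loop $(B,m)$; a Lie group $G$ with neutral element $e$ and an analytic right action $\sigma:B\times G\to B$ with $\sigma(\varepsilon,g)=\varepsilon$; a smooth bivector field $P$ on $B$ with $P(\varepsilon)=0$; an analytic map $\alpha:B\times B\to G$ with $\alpha(a,\varepsilon)=\alpha(\varepsilon,a)=e$; an analytic map $\chi:B\times G\to G$ with $\chi(\varepsilon,g)=g$, $\chi(a,e)=e$ which is an $\alpha$-twisted left action, that is, $$\chi(a,\chi(b,g))\,\alpha\big(\sigma(a,\chi(b,g)),\sigma(b,g)\big)=\alpha(a,b)\,\chi(m(a,b),g);$$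 and a nondegenerate bilinear form $\langle\cdot,\cdot\rangle:T_eG\times T_\varepsilon B\to\mathbb R$. Write $x^\lambda(a)=(T_\varepsilon\lambda_a)(x)$ for $x\in T_\varepsilon B$ (extended to $\Lambda^2T_\varepsilon B$), $\rho_B(\xi)(a)=\frac{d}{dt}\big|_{0}\sigma(a,\exp t\xi)$ for $\xi\in T_eG$, $\mu:\Lambda^2T_\varepsilon B\to T_\varepsilon B$ and $\psi:\Lambda^2T_\varepsilon B\to T_eG$ for the brackets associated with $m$ and $\alpha$ (in local charts, the second-order terms at $(\varepsilon,\varepsilon)$ of $m(a,b)-m(b,a)$ and of $\alpha(a,b)-\alpha(b,a)$), and $x^\xi\in T_\varepsilon B$, $\xi^x\in T_eG$ for the mixed second derivatives of $\sigma$ and of $\chi$ at $(\varepsilon,e)$ in the directions $x$ and $\xi$. The form is required to be invariant: $$\langle\xi,\mu(x,y)\rangle=\langle\xi^y,x\rangle,\qquad\langle[\xi,\eta],x\rangle=\langle\eta,x^\xi\rangle,\qquad\langle\psi(x,y),z\rangle=\langle\psi(y,z),x\rangle .$$ It identifies $T_eG$ with $(T_\varepsilon B)^*$, hence $\psi$ with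 an element of $\Lambda^3T_eG$ and $\psi(x)=\psi(x,\cdot)$ with an element of $\Lambda^2T_eG$. Finally, the following are required: 1. $m(m(a,b),c)=m(\sigma(a,\alpha(b,c)),m(b,c))$ for all $a,b,c\in B$; 2. $\alpha(a,b)\,\alpha(m(a,b),c)=\chi(a,\alpha(b,c))\,\alpha(\sigma(a,\alpha(b,c)),m(b,c))$ for all $a,b,c\in B$; 3. $\tfrac12[P,P]_S=-(\Lambda^3\rho_B)(\psi)$, where $[\cdot,\cdot]_S$ is the Schouten bracket, in either of its two usual sign conventions; 4. $L_{x^\lambda}P=[(L_{x^\lambda}P)(\varepsilon)]^\lambda-(\Lambda^2\rho_B)(\psi(x))$ for all $x\in T_\varepsilon B$. It is *local* if the operations are defined, and all these conditions hold, only near $\varepsilon$ and $e$. **Proposition 3.** Let $(B,m,G,\sigma,P,\alpha,\chi,\langle\cdot,\cdot\rangle)$ be a quasi-Poisson Lie quasigroup or a local quasi-Poisson Lie quasigroup, and put $\gamma(x)=(L_{x^\lambda}P)(\varepsilon)$ for $x\in T_\varepsilon B$. Then $\gamma:T_\varepsilon B\to\Lambda^2T_\varepsilon B$ is linear and 1.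 $\gamma^2=0$, where $\gamma^2(x)\in\Lambda^3T_\varepsilon B$ is the image of $\gamma(x)$ under the extension of $\gamma$ to a graded derivation of the exterior algebra, $u\wedge v\mapsto\gamma(u)\wedge v-u\wedge\gamma(v)$; equivalently, $\mathrm{Alt}\,(\gamma\otimes\mathrm{Id})\gamma(x)=0$ for all $x$, where $\mathrm{Alt}$ is the sum over the cyclic permutations of the three factors. That is, $\gamma$ is a Lie cobracket. 2. $\gamma(\mu(x,y))=\mu(\gamma(x),y)+\mu(x,\gamma(y))$ for all $x,y\in T_\varepsilon B$, where $\mu(u\wedge v,y)=\mu(u,y)\wedge v+u\wedge\mu(v,y)$ and $\mu(x,u\wedge v)=\mu(x,u)\wedge v+u\wedge\mu(x,v)$. -/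

import Mathlib

open Filter Topology
open scoped Manifold ContDiff

noncomputable section

/-! ### Bivectors

A bivector on a finite-dimensional real vector space `V` is an element of `Λ²V`, regarded as an
alternating bilinear form on the dual of `V` through
`(u ∧ v)(ξ, η) = ξ(u) η(v) - ξ(v) η(u)`. -/

section Bivectors

/-- `Λ²V`, for `V` of finite dimension: the alternating bilinear forms on the dual of `V`. -/
abbrev Bivector (V : Type*) [AddCommGroup V] [Module ℝ V] [TopologicalSpace V] : Type _ :=
  (V →L[ℝ] ℝ) [⋀^Fin 2]→L[ℝ] ℝ

variable {V W : Type*} [AddCommGroup V] [Module ℝ V] [TopologicalSpace V]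
  [IsTopologicalAddGroup V] [ContinuousSMul ℝ V]
  [AddCommGroup W] [Module ℝ W] [TopologicalSpace W]
  [IsTopologicalAddGroup W] [ContinuousSMul ℝ W]

/-- `Λ²A : Λ²V → Λ²W` for a linear map `A : V → W`, that is `u ∧ v ↦ A u ∧ A v`. -/
def Bivector.map (A : V →L[ℝ] W) (P : Bivector V) : Bivector W :=
  P.compContinuousLinearMap (ContinuousLinearMap.precomp ℝ A)

/-- The derivation `Λ²V → Λ²V` that extends an endomorphism `A` of `V`,
that is `u ∧ v ↦ A u ∧ v + u ∧ A v`. -/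
def Bivector.derivation (A : V →L[ℝ] V) (P : Bivector V) : Bivector V :=
  ContinuousMultilinearMap.alternatization
    (P.toContinuousMultilinearMap.compContinuousLinearMap
      ![ContinuousLinearMap.precomp ℝ A, ContinuousLinearMap.id ℝ (V →L[ℝ] ℝ)])

theorem Bivector.derivation_apply (A : V →L[ℝ] V) (P : Bivector V) (ξ η : V →L[ℝ] ℝ) :
    Bivector.derivation A P ![ξ, η] = P ![ξ.comp A, η] + P ![ξ, η.comp A] := by
  have h : P ![η.comp A, ξ] = - P ![ξ, η.comp A] := by
    have := P.map_swap ![ξ, η.comp A] (i := 0) (j := 1) (by decide)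
    change P (![ξ, η.comp A] ∘ Equiv.swap 0 1) = - P ![ξ, η.comp A] at this
    rw [← this]
    congr 1
    ext i
    fin_cases i <;> simp
  have e1 : ∀ x y : V →L[ℝ] ℝ, (P.toContinuousMultilinearMap.compContinuousLinearMap
      ![ContinuousLinearMap.precomp ℝ A, ContinuousLinearMap.id ℝ (V →L[ℝ] ℝ)]) ![x, y]
      = P ![x.comp A, y] := by
    intro x y
    rw [ContinuousMultilinearMap.compContinuousLinearMap_apply]
    change P _ = P _
    congr 1
    ext i
    fin_cases i <;> simp
  have e2 : (![ξ, η] ∘ (Equiv.swap (0 : Fin 2) 1) : Fin 2 → V →L[ℝ] ℝ) = ![η, ξ] := by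
    ext i
    fin_cases i <;> simp
  unfold Bivector.derivation
  rw [ContinuousMultilinearMap.alternatization_apply_apply]
  have hu : (Finset.univ : Finset (Equiv.Perm (Fin 2))) = {1, Equiv.swap 0 1} := by decide
  have h1 : (1 : Equiv.Perm (Fin 2)) ≠ Equiv.swap 0 1 := by decide
  rw [hu, Finset.sum_pair h1, e2, Equiv.Perm.sign_swap (by decide)]
  simp only [Equiv.Perm.sign_one, one_smul, Equiv.Perm.coe_one, Function.comp_id, e1, h]
  simp

/-- The transpose `Λ²V* → V*` of a linear map `γ : V → Λ²V`, as a bracket on the dual of `V`: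
`⟨[ξ, η]_γ, x⟩ = γ(x)(ξ, η)`. -/
def transposeBracket (γ : V →L[ℝ] Bivector V) (ξ η : V →L[ℝ] ℝ) : V →L[ℝ] ℝ :=
  (ContinuousAlternatingMap.apply ℝ (V →L[ℝ] ℝ) ℝ ![ξ, η]).comp γ

/-- `γ²(x) ∈ Λ³V`, as an alternating trilinear form on the dual of `V`. It is the image of `γ(x)`
under the extension of `γ` to a graded derivation `Λ²V → Λ³V`,
`u ∧ v ↦ γ(u) ∧ v - u ∧ γ(v)`; equivalently, it is the sum `Alt ((γ ⊗ Id) γ(x))` over the cyclic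
permutations of the three factors, because `((γ ⊗ Id) t)(ξ, η, ζ) = t([ξ, η]_γ, ζ)` for `t ∈ Λ²V`.
So `γ² = 0` is the co-Jacobi identity. -/
def cobracketSq (γ : V →L[ℝ] Bivector V) (x : V) (ξ η ζ : V →L[ℝ] ℝ) : ℝ :=
  γ x ![transposeBracket γ ξ η, ζ] + γ x ![transposeBracket γ η ζ, ξ]
    + γ x ![transposeBracket γ ζ ξ, η]

end Bivectors

/-! ### Vector fields and bivector fields on a manifold

`B` is a manifold modelled on `E`. The tangent space at `x` is identified with `E` by the
derivative at `x` of the preferred chart at `x`; all local formulas below are written in that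
chart. -/

section Fields

variable {E : Type*} [NormedAddCommGroup E] [NormedSpace ℝ E]
  {B : Type*} [TopologicalSpace B] [ChartedSpace E B]

/-- The vector field `X` in the preferred chart at `c`. -/
def vectorFieldInChart (X : ∀ z : B, TangentSpace 𝓘(ℝ, E) z) (c : B) (y : E) : E :=
  mfderiv 𝓘(ℝ, E) 𝓘(ℝ, E) (extChartAt 𝓘(ℝ, E) c) ((extChartAt 𝓘(ℝ, E) c).symm y)
    (X ((extChartAt 𝓘(ℝ, E) c).symm y))

/-- The bivector field `P` in the preferred chart at `c`. -/
def bivectorFieldInChart (P : ∀ z : B, Bivector (TangentSpace 𝓘(ℝ, E) z)) (c : B) (y : E) :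
    Bivector E :=
  Bivector.map
    (mfderiv 𝓘(ℝ, E) 𝓘(ℝ, E) (extChartAt 𝓘(ℝ, E) c) ((extChartAt 𝓘(ℝ, E) c).symm y))
    (P ((extChartAt 𝓘(ℝ, E) c).symm y))

/-- `P` is a smooth bivector field at `x`. -/
def SmoothBivectorFieldAt (P : ∀ z : B, Bivector (TangentSpace 𝓘(ℝ, E) z)) (x : B) : Prop :=
  ContDiffAt ℝ ∞ (bivectorFieldInChart P x) (extChartAt 𝓘(ℝ, E) x x)

/-- The Lie derivative `(L_X P)(x)`: in coordinates, `DP(X)` minus the derivation of `Λ²E` that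
extends `DX`, so that `L_X (Y ∧ Z) = [X, Y] ∧ Z + Y ∧ [X, Z]`. -/
def lieDerivBivector (X : ∀ z : B, TangentSpace 𝓘(ℝ, E) z)
    (P : ∀ z : B, Bivector (TangentSpace 𝓘(ℝ, E) z)) (x : B) :
    Bivector (TangentSpace 𝓘(ℝ, E) x) :=
  let y : E := extChartAt 𝓘(ℝ, E) x x
  (fderiv ℝ (bivectorFieldInChart P x) y (vectorFieldInChart X x y)
    - Bivector.derivation (fderiv ℝ (vectorFieldInChart X x) y) (bivectorFieldInChart P x y) :
      Bivector E)

/-- The Schouten bracket `[P, Q]_S(x) ∈ Λ³T_xB` of two bivector fields, as a trilinear form on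
cotangent vectors. In coordinates it is
`[P, Q]^{ijk} = s ∑ (P^{il} ∂_l Q^{jk} + Q^{il} ∂_l P^{jk})`, the sum over the cyclic permutations
of `(i, j, k)`. The sign `s` is the convention: `s = 1` is the one in which
`[X₁ ∧ X₂, Y₁ ∧ Y₂] = ∑ (-1)^{i+j} [X_i, Y_j] ∧ X_{3-i} ∧ Y_{3-j}`, and `s = -1` is the
opposite one, which is also in use. -/
def schoutenBracket (s : ℤˣ) (P Q : ∀ z : B, Bivector (TangentSpace 𝓘(ℝ, E) z)) (x : B)
    (β : Fin 3 → (TangentSpace 𝓘(ℝ, E) x →L[ℝ] ℝ)) : ℝ :=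
  let y : E := extChartAt 𝓘(ℝ, E) x x
  let b : Fin 3 → (E →L[ℝ] ℝ) := β
  let p := bivectorFieldInChart P x
  let q := bivectorFieldInChart Q x
  ((s : ℤ) : ℝ) * ∑ i : Fin 3,
    (p y ![b i, fderiv ℝ (fun w => q w ![b (i + 1), b (i + 2)]) y]
      + q y ![b i, fderiv ℝ (fun w => p w ![b (i + 1), b (i + 2)]) y])

end Fields

/-- The mixed second derivative at `(p, q)` of a map `f : M × M' → N`, in the preferred charts at
`p`, `q` and `f (p, q)`: the bilinear map `(x, y) ↦ ∂ₓ∂_y f`. -/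
def mixedDeriv {E₁ E₂ E₃ M M' N : Type*}
    [NormedAddCommGroup E₁] [NormedSpace ℝ E₁] [NormedAddCommGroup E₂] [NormedSpace ℝ E₂]
    [NormedAddCommGroup E₃] [NormedSpace ℝ E₃]
    [TopologicalSpace M] [ChartedSpace E₁ M] [TopologicalSpace M'] [ChartedSpace E₂ M']
    [TopologicalSpace N] [ChartedSpace E₃ N] (f : M → M' → N) (p : M) (q : M') :
    E₁ →L[ℝ] E₂ →L[ℝ] E₃ :=
  fderiv ℝ (fun u : E₁ => fderiv ℝ (fun v : E₂ => extChartAt 𝓘(ℝ, E₃) (f p q)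
      (f ((extChartAt 𝓘(ℝ, E₁) p).symm u) ((extChartAt 𝓘(ℝ, E₂) q).symm v)))
    (extChartAt 𝓘(ℝ, E₂) q q)) (extChartAt 𝓘(ℝ, E₁) p p)

/-! ### Lie loops -/

section Loops

variable {E : Type*} [NormedAddCommGroup E] [NormedSpace ℝ E]
  {B : Type*} [TopologicalSpace B] [ChartedSpace E B]

/-- `(B, m)` is an analytic loop with neutral element `ε`: the equations `a.b = c` and `b.a = c`
have unique solutions `b = a \ c` and `b = c / a`, and these depend analytically on `(a, c)`. -/
structure IsLieLoop (m : B → B → B) (ε : B) : Prop where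
  analytic : ContMDiff (𝓘(ℝ, E).prod 𝓘(ℝ, E)) 𝓘(ℝ, E) ω (fun p : B × B => m p.1 p.2)
  mul_unit : ∀ a, m a ε = a
  unit_mul : ∀ a, m ε a = a
  left_div : ∃ d : B → B → B,
    ContMDiff (𝓘(ℝ, E).prod 𝓘(ℝ, E)) 𝓘(ℝ, E) ω (fun p : B × B => d p.1 p.2) ∧
      ∀ a b c, m a b = c ↔ b = d a c
  right_div : ∃ d : B → B → B,
    ContMDiff (𝓘(ℝ, E).prod 𝓘(ℝ, E)) 𝓘(ℝ, E) ω (fun p : B × B => d p.1 p.2) ∧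
      ∀ a b c, m b a = c ↔ b = d a c

/-- The local version: the three operations are defined, and the identities hold, near `ε`.
(The values of `m` far from `(ε, ε)` are irrelevant.) -/
structure IsLocalLieLoop (m : B → B → B) (ε : B) : Prop where
  analytic : ContMDiffAt (𝓘(ℝ, E).prod 𝓘(ℝ, E)) 𝓘(ℝ, E) ω (fun p : B × B => m p.1 p.2) (ε, ε)
  mul_unit : ∀ᶠ a in 𝓝 ε, m a ε = a
  unit_mul : ∀ᶠ a in 𝓝 ε, m ε a = a
  left_div : ∃ d : B → B → B,
    ContMDiffAt (𝓘(ℝ, E).prod 𝓘(ℝ, E)) 𝓘(ℝ, E) ω (fun p : B × B => d p.1 p.2) (ε, ε) ∧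
      ∀ᶠ p : B × B × B in 𝓝 (ε, ε, ε), m p.1 p.2.1 = p.2.2 ↔ p.2.1 = d p.1 p.2.2
  right_div : ∃ d : B → B → B,
    ContMDiffAt (𝓘(ℝ, E).prod 𝓘(ℝ, E)) 𝓘(ℝ, E) ω (fun p : B × B => d p.1 p.2) (ε, ε) ∧
      ∀ᶠ p : B × B × B in 𝓝 (ε, ε, ε), m p.2.1 p.1 = p.2.2 ↔ p.2.1 = d p.1 p.2.2

/-- Right mono-alternativity: `(a b^k) b^l = a b^(k+l)` for all integers `k`, `l` and all `a`, `b`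
near `ε`. (With `a = ε`, the identity determines the powers `b^k` from `b^0 = ε` and
`b^1 = b`.) -/
def IsRightMonoAlternative (m : B → B → B) (ε : B) : Prop :=
  ∃ pow : B → ℤ → B,
    (∀ k, pow ε k = ε ∧ ContinuousAt (fun b => pow b k) ε) ∧
    (∀ᶠ b in 𝓝 ε, pow b 0 = ε ∧ pow b 1 = b) ∧
    ∀ k l : ℤ, ∀ᶠ p : B × B in 𝓝 (ε, ε),
      m (m p.1 (pow p.2 k)) (pow p.2 l) = m p.1 (pow p.2 (k + l))

end Loops

/-! ### Quasi-Poisson Lie quasigroups -/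

/-- The data `(B, m, G, σ, P, α, χ, ⟨., .⟩)`, where `B` is a manifold modelled on `E`
with base point `ε` and `G` is a Lie group modelled on `F`. In the local case the values of `m`,
`σ`, `α`, `χ` and `P` matter only near `ε` (and the neutral element of `G`). -/
structure QuasiPoissonData (E F B G : Type*)
    [NormedAddCommGroup E] [NormedSpace ℝ E] [NormedAddCommGroup F] [NormedSpace ℝ F]
    [TopologicalSpace B] [ChartedSpace E B]
    [TopologicalSpace G] [ChartedSpace F G] [Group G] where
  /-- the neutral element -/
  ε : B
  /-- the product of `B` -/
  m : B → B → B
  /-- the right action of `G` on `B` -/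
  σ : B → G → B
  /-- the bivector field on `B` -/
  P : ∀ a : B, Bivector (TangentSpace 𝓘(ℝ, E) a)
  /-- the associator map -/
  α : B → B → G
  /-- the twisted left action of `B` on `G` -/
  χ : B → G → G
  /-- the bilinear form on `T_eG × T_εB` -/
  pair : GroupLieAlgebra 𝓘(ℝ, F) G →ₗ[ℝ] TangentSpace 𝓘(ℝ, E) ε →ₗ[ℝ] ℝ
  nondegenerate : pair.Nondegenerate

namespace QuasiPoissonData

variable {E F B G : Type*}
  [NormedAddCommGroup E] [NormedSpace ℝ E] [FiniteDimensional ℝ E]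
  [NormedAddCommGroup F] [NormedSpace ℝ F]
  [TopologicalSpace B] [ChartedSpace E B]
  [TopologicalSpace G] [ChartedSpace F G] [Group G]
  (Q : QuasiPoissonData E F B G)

/-- `T_εB` -/
abbrev TB : Type _ := TangentSpace 𝓘(ℝ, E) Q.ε

/-- The bracket on `T_εB` associated with `m`: `m(x, y) - m(y, x) = μ(x, y) + …` in a chart. -/
def μ : Q.TB →L[ℝ] Q.TB →L[ℝ] Q.TB :=
  (mixedDeriv Q.m Q.ε Q.ε - (mixedDeriv Q.m Q.ε Q.ε).flip : E →L[ℝ] E →L[ℝ] E)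

/-- The map `x ↦ μ(x, y)` for fixed `y`. -/
def μRight (y : Q.TB) : Q.TB →L[ℝ] Q.TB :=
  (show E →L[ℝ] E →L[ℝ] E from Q.μ).flip (show E from y)

theorem μRight_apply (x y : Q.TB) : Q.μRight y x = Q.μ x y := rfl

/-- The commutator bracket `T_εB × T_εB → T_eG` associated with `α`. -/
def ψ : Q.TB →L[ℝ] Q.TB →L[ℝ] GroupLieAlgebra 𝓘(ℝ, F) G :=
  (mixedDeriv Q.α Q.ε Q.ε - (mixedDeriv Q.α Q.ε Q.ε).flip : E →L[ℝ] E →L[ℝ] F)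

/-- `x^ξ ∈ T_εB` for `x ∈ T_εB` and `ξ ∈ T_eG`, the infinitesimal form of `σ`. -/
def infσ : Q.TB →L[ℝ] GroupLieAlgebra 𝓘(ℝ, F) G →L[ℝ] Q.TB :=
  (mixedDeriv Q.σ Q.ε (1 : G) : E →L[ℝ] F →L[ℝ] E)

/-- `ξ^x ∈ T_eG` for `x ∈ T_εB` and `ξ ∈ T_eG`, the infinitesimal form of `χ`. -/
def infχ : Q.TB →L[ℝ] GroupLieAlgebra 𝓘(ℝ, F) G →L[ℝ] GroupLieAlgebra 𝓘(ℝ, F) G :=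
  (mixedDeriv Q.χ Q.ε (1 : G) : E →L[ℝ] F →L[ℝ] F)

/-- `x ↦ x^λ(a)`, the derivative at `ε` of the left translation by `a` (and `m(a, ε) = a`). -/
def lam (a : B) : Q.TB →L[ℝ] TangentSpace 𝓘(ℝ, E) a :=
  mfderiv 𝓘(ℝ, E) 𝓘(ℝ, E) (fun b => Q.m a b) Q.ε

/-- `ξ ↦ ρ_B(ξ)(a)`, the derivative of `g ↦ σ(a, g)` at the neutral element of `G` (where
`σ(a, e) = a`). -/
def rho (a : B) : GroupLieAlgebra 𝓘(ℝ, F) G →L[ℝ] TangentSpace 𝓘(ℝ, E) a :=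
  mfderiv 𝓘(ℝ, F) 𝓘(ℝ, E) (fun g => Q.σ a g) (1 : G)

/-- The vector field `x^λ`. -/
def lamField (x : Q.TB) : ∀ a : B, TangentSpace 𝓘(ℝ, E) a := fun a => Q.lam a x

instance pair_isPerfPair : Q.pair.IsPerfPair := by
  have : FiniteDimensional ℝ (TangentSpace 𝓘(ℝ, E) Q.ε) :=
    inferInstanceAs (FiniteDimensional ℝ E)
  exact LinearMap.IsPerfPair.of_injective'
    (LinearMap.ker_eq_bot.mp (LinearMap.separatingLeft_iff_ker_eq_bot.mp Q.nondegenerate.1))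
    (LinearMap.ker_eq_bot.mp (LinearMap.separatingRight_iff_flip_ker_eq_bot.mp Q.nondegenerate.2))

/-- The isomorphism `(T_eG)* → T_εB` given by the pairing: `⟨ξ, sharp p⟩ = p(ξ)` for all `ξ`. -/
def sharp (p : GroupLieAlgebra 𝓘(ℝ, F) G →L[ℝ] ℝ) : Q.TB :=
  Q.pair.flip.toPerfPair.symm (p : GroupLieAlgebra 𝓘(ℝ, F) G →ₗ[ℝ] ℝ)

/-- `ψ(x)` as an element of `Λ²T_eG`: the pairing turns the form `(y, z) ↦ ⟨ψ(x, y), z⟩` on `T_εB`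
into a form on `(T_eG)*`. -/
def ψ₂ (x : Q.TB) (p q : GroupLieAlgebra 𝓘(ℝ, F) G →L[ℝ] ℝ) : ℝ :=
  Q.pair (Q.ψ x (Q.sharp p)) (Q.sharp q)

/-- `ψ` as an element of `Λ³T_eG`: the pairing turns the form `(x, y, z) ↦ ⟨ψ(x, y), z⟩` on `T_εB`
into a form on `(T_eG)*`. -/
def ψ₃ (p q r : GroupLieAlgebra 𝓘(ℝ, F) G →L[ℝ] ℝ) : ℝ :=
  Q.pair (Q.ψ (Q.sharp p) (Q.sharp q)) (Q.sharp r)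

/-- Invariance of the pairing: `⟨ξ, μ(x, y)⟩ = ⟨ξ^y, x⟩`, `⟨[ξ, η], x⟩ = ⟨η, x^ξ⟩`,
`⟨ψ(x, y), z⟩ = ⟨ψ(y, z), x⟩`. -/
structure PairInvariant : Prop where
  inv_μ : ∀ (ξ : GroupLieAlgebra 𝓘(ℝ, F) G) (x y : Q.TB),
    Q.pair ξ (Q.μ x y) = Q.pair (Q.infχ y ξ) x
  inv_bracket : ∀ (ξ η : GroupLieAlgebra 𝓘(ℝ, F) G) (x : Q.TB),
    Q.pair ⁅ξ, η⁆ x = Q.pair η (Q.infσ x ξ)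
  inv_ψ : ∀ x y z : Q.TB, Q.pair (Q.ψ x y) z = Q.pair (Q.ψ y z) x

/-- `½ [P, P]_S = - (Λ³ρ_B)(ψ)` at the point `a`. -/
def SchoutenCondition (s : ℤˣ) (a : B) : Prop :=
  ∀ β : Fin 3 → (TangentSpace 𝓘(ℝ, E) a →L[ℝ] ℝ),
    (1 / 2 : ℝ) * schoutenBracket s Q.P Q.P a β
      = - Q.ψ₃ ((β 0).comp (Q.rho a)) ((β 1).comp (Q.rho a)) ((β 2).comp (Q.rho a))

/-- `L_{x^λ} P = [(L_{x^λ} P)(ε)]^λ - (Λ²ρ_B)(ψ(x))` at the point `a`, for all `x`. -/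
def LieDerivCondition (a : B) : Prop :=
  ∀ (x : Q.TB) (β₁ β₂ : TangentSpace 𝓘(ℝ, E) a →L[ℝ] ℝ),
    lieDerivBivector (Q.lamField x) Q.P a ![β₁, β₂]
      = Bivector.map (Q.lam a) (lieDerivBivector (Q.lamField x) Q.P Q.ε) ![β₁, β₂]
        - Q.ψ₂ x (β₁.comp (Q.rho a)) (β₂.comp (Q.rho a))

/-- Quasi-Poisson Lie quasigroups. The sign `s` is the convention for the Schouten bracket. -/
structure IsQuasiPoisson (s : ℤˣ) : Prop where
  loop : IsLieLoop (E := E) Q.m Q.ε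
  mono : IsRightMonoAlternative Q.m Q.ε
  -- `σ` is an analytic right action of `G` on `B` that fixes `ε`
  σ_analytic : ContMDiff (𝓘(ℝ, E).prod 𝓘(ℝ, F)) 𝓘(ℝ, E) ω (fun p : B × G => Q.σ p.1 p.2)
  σ_one : ∀ a, Q.σ a 1 = a
  σ_mul : ∀ a g h, Q.σ (Q.σ a g) h = Q.σ a (g * h)
  σ_unit : ∀ g, Q.σ Q.ε g = Q.ε
  -- `α` is analytic and normalized
  α_analytic : ContMDiff (𝓘(ℝ, E).prod 𝓘(ℝ, E)) 𝓘(ℝ, F) ω (fun p : B × B => Q.α p.1 p.2)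
  α_unit_left : ∀ a, Q.α Q.ε a = 1
  α_unit_right : ∀ a, Q.α a Q.ε = 1
  -- `χ` is an analytic, normalized, `α`-twisted left action of `B` on `G`
  χ_analytic : ContMDiff (𝓘(ℝ, E).prod 𝓘(ℝ, F)) 𝓘(ℝ, F) ω (fun p : B × G => Q.χ p.1 p.2)
  χ_unit : ∀ g, Q.χ Q.ε g = g
  χ_one : ∀ a, Q.χ a 1 = 1
  χ_twisted : ∀ a b g,
    Q.χ a (Q.χ b g) * Q.α (Q.σ a (Q.χ b g)) (Q.σ b g) = Q.α a b * Q.χ (Q.m a b) g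
  -- `P` is a smooth bivector field that vanishes at `ε`
  P_smooth : ∀ a, SmoothBivectorFieldAt Q.P a
  P_unit : Q.P Q.ε = 0
  invariant : Q.PairInvariant
  assoc : ∀ a b c, Q.m (Q.m a b) c = Q.m (Q.σ a (Q.α b c)) (Q.m b c)
  cocycle : ∀ a b c,
    Q.α a b * Q.α (Q.m a b) c = Q.χ a (Q.α b c) * Q.α (Q.σ a (Q.α b c)) (Q.m b c)
  schouten : ∀ a, Q.SchoutenCondition s a
  lieDeriv : ∀ a, Q.LieDerivCondition a

/-- Local quasi-Poisson Lie quasigroups: the same conditions, near the neutral elements. -/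
structure IsLocalQuasiPoisson (s : ℤˣ) : Prop where
  loop : IsLocalLieLoop (E := E) Q.m Q.ε
  mono : IsRightMonoAlternative Q.m Q.ε
  σ_analytic : ContMDiffAt (𝓘(ℝ, E).prod 𝓘(ℝ, F)) 𝓘(ℝ, E) ω
    (fun p : B × G => Q.σ p.1 p.2) (Q.ε, 1)
  σ_one : ∀ᶠ a in 𝓝 Q.ε, Q.σ a 1 = a
  σ_mul : ∀ᶠ p : B × G × G in 𝓝 (Q.ε, 1, 1),
    Q.σ (Q.σ p.1 p.2.1) p.2.2 = Q.σ p.1 (p.2.1 * p.2.2)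
  σ_unit : ∀ᶠ g in 𝓝 (1 : G), Q.σ Q.ε g = Q.ε
  α_analytic : ContMDiffAt (𝓘(ℝ, E).prod 𝓘(ℝ, E)) 𝓘(ℝ, F) ω
    (fun p : B × B => Q.α p.1 p.2) (Q.ε, Q.ε)
  α_unit_left : ∀ᶠ a in 𝓝 Q.ε, Q.α Q.ε a = 1
  α_unit_right : ∀ᶠ a in 𝓝 Q.ε, Q.α a Q.ε = 1
  χ_analytic : ContMDiffAt (𝓘(ℝ, E).prod 𝓘(ℝ, F)) 𝓘(ℝ, F) ω
    (fun p : B × G => Q.χ p.1 p.2) (Q.ε, 1)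
  χ_unit : ∀ᶠ g in 𝓝 (1 : G), Q.χ Q.ε g = g
  χ_one : ∀ᶠ a in 𝓝 Q.ε, Q.χ a 1 = 1
  χ_twisted : ∀ᶠ p : B × B × G in 𝓝 (Q.ε, Q.ε, 1),
    Q.χ p.1 (Q.χ p.2.1 p.2.2) * Q.α (Q.σ p.1 (Q.χ p.2.1 p.2.2)) (Q.σ p.2.1 p.2.2)
      = Q.α p.1 p.2.1 * Q.χ (Q.m p.1 p.2.1) p.2.2
  P_smooth : ∀ᶠ a in 𝓝 Q.ε, SmoothBivectorFieldAt Q.P a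
  P_unit : Q.P Q.ε = 0
  invariant : Q.PairInvariant
  assoc : ∀ᶠ p : B × B × B in 𝓝 (Q.ε, Q.ε, Q.ε),
    Q.m (Q.m p.1 p.2.1) p.2.2
      = Q.m (Q.σ p.1 (Q.α p.2.1 p.2.2)) (Q.m p.2.1 p.2.2)
  cocycle : ∀ᶠ p : B × B × B in 𝓝 (Q.ε, Q.ε, Q.ε),
    Q.α p.1 p.2.1 * Q.α (Q.m p.1 p.2.1) p.2.2
      = Q.χ p.1 (Q.α p.2.1 p.2.2)
        * Q.α (Q.σ p.1 (Q.α p.2.1 p.2.2)) (Q.m p.2.1 p.2.2)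
  schouten : ∀ᶠ a in 𝓝 Q.ε, Q.SchoutenCondition s a
  lieDeriv : ∀ᶠ a in 𝓝 Q.ε, Q.LieDerivCondition a

end QuasiPoissonData

end

noncomputable section

set_option maxSynthPendingDepth 3

/-! ### Calculus of bivector fields on a vector space -/

section Coordinates

variable {E : Type*} [NormedAddCommGroup E] [NormedSpace ℝ E]

/-! Since `P` vanishes at `ε`, the coordinate formula for the Lie derivative at `ε` reduces to its
first term, so `γ` is the derivative of `P` at `ε`. The claims are the first-order parts at `ε` of
the two differential conditions.

The correction terms built from `ψ` do not contribute. The action fixes `ε`, so `ρ_B` vanishes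
there, and these terms are quadratic or cubic in `ρ_B`; their derivative at `ε` is zero
(`hasFDerivAt_ψ₂_comp`, `hasFDerivAt_ψ₃_comp`).

In coordinates `[P, P]` is a cyclic sum of products `P · ∂P`. Its derivative at a zero of `P`
contains only products `∂P · ∂P`, and these assemble to `γ²` up to a nonzero factor
(`cobracketSq_eq_zero_of_schoutenForm`).

Write `x^λ = Λ x` with `Λ(ε) = id`. Differentiating the condition on `L_{x^λ} P` in the direction
`z` gives the second derivative `D²P(z, x)` plus terms in `γ` and `DΛ`. Exchanging `x` and `z` and
subtracting removes `D²P`, which is symmetric, and leaves only the antisymmetrization of `DΛ`, which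
is `μ` (`fderiv_bivector_derivation`).

The conditions are stated at each point `a` in the preferred chart at `a`, while differentiating at
`ε` needs one fixed chart. Hence the naturality lemmas `lieForm_pushforward` and
`schoutenForm_pushforward`, which show that the second derivatives of a change of chart cancel. -/

theorem Bivector.swap_apply (P : Bivector E) (ξ η : E →L[ℝ] ℝ) : P ![η, ξ] = - P ![ξ, η] := by
  have : P (![ξ, η] ∘ Equiv.swap 0 1) = - P ![ξ, η] :=
    P.map_swap ![ξ, η] (i := 0) (j := 1) (by decide)
  rw [← this]
  congr 1
  ext i
  fin_cases i <;> simp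

theorem Bivector.map_apply {V W : Type*} [AddCommGroup V] [Module ℝ V] [TopologicalSpace V]
    [AddCommGroup W] [Module ℝ W] [TopologicalSpace W] (A : V →L[ℝ] W) (P : Bivector V)
    (ξ η : W →L[ℝ] ℝ) :
    Bivector.map A P ![ξ, η] = P ![ξ.comp A, η.comp A] := by
  unfold Bivector.map
  rw [ContinuousAlternatingMap.compContinuousLinearMap_apply]
  congr 1
  ext i
  fin_cases i <;> simp

theorem Bivector.apply_add_left (P : Bivector E) (ξ ξ' η : E →L[ℝ] ℝ) :
    P ![ξ + ξ', η] = P ![ξ, η] + P ![ξ', η] := by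
  have u : ∀ ζ, Function.update ![ξ, η] 0 ζ = ![ζ, η] := fun ζ => by
    ext i; fin_cases i <;> rfl
  have := P.map_update_add ![ξ, η] 0 ξ ξ'
  rwa [u, u, u] at this

theorem Bivector.apply_smul_left (P : Bivector E) (c : ℝ) (ξ η : E →L[ℝ] ℝ) :
    P ![c • ξ, η] = c * P ![ξ, η] := by
  have u : ∀ ζ, Function.update ![ξ, η] 0 ζ = ![ζ, η] := fun ζ => by
    ext i; fin_cases i <;> rfl
  have := P.map_update_smul ![ξ, η] 0 c ξ
  rwa [u, u] at this

theorem Bivector.apply_add_right (P : Bivector E) (ξ η η' : E →L[ℝ] ℝ) :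
    P ![ξ, η + η'] = P ![ξ, η] + P ![ξ, η'] := by
  rw [P.swap_apply, P.apply_add_left, P.swap_apply ξ η, P.swap_apply ξ η']
  ring

theorem Bivector.apply_smul_right (P : Bivector E) (c : ℝ) (ξ η : E →L[ℝ] ℝ) :
    P ![ξ, c • η] = c * P ![ξ, η] := by
  rw [P.swap_apply, P.apply_smul_left, P.swap_apply ξ η]
  ring

theorem Bivector.apply_sub_right (P : Bivector E) (ξ η η' : E →L[ℝ] ℝ) :
    P ![ξ, η - η'] = P ![ξ, η] - P ![ξ, η'] := by
  have := P.apply_add_right ξ (η - η') η'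
  rw [sub_add_cancel] at this
  linarith

theorem Bivector.apply_sub_left (P : Bivector E) (ξ ξ' η : E →L[ℝ] ℝ) :
    P ![ξ - ξ', η] = P ![ξ, η] - P ![ξ', η] := by
  have := P.apply_add_left (ξ - ξ') ξ' η
  rw [sub_add_cancel] at this
  linarith

theorem Bivector.ext_pair {V : Type*} [AddCommGroup V] [Module ℝ V] [TopologicalSpace V]
    {P P' : Bivector V} (h : ∀ ξ η, P ![ξ, η] = P' ![ξ, η]) : P = P' := by
  ext v
  have : v = ![v 0, v 1] := by
    ext i
    fin_cases i <;> rfl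
  rw [this]
  exact h _ _

/-- Contraction of a bivector with a covector, in finite dimension. -/
theorem Bivector.exists_contraction [FiniteDimensional ℝ E] (P : Bivector E) (ξ : E →L[ℝ] ℝ) :
    ∃ v : E, ∀ η : E →L[ℝ] ℝ, P ![ξ, η] = η v := by
  -- The form `P(ξ, ·)` lies in the double dual, hence is evaluation at a vector.
  let ℓ : Module.Dual ℝ (Module.Dual ℝ E) :=
    { toFun := fun f => P ![ξ, LinearMap.toContinuousLinearMap f]
      map_add' := fun f g => by rw [map_add, P.apply_add_right]
      map_smul' := fun c f => by rw [map_smul, P.apply_smul_right]; rfl }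
  refine ⟨(Module.evalEquiv ℝ E).symm ℓ, fun η => ?_⟩
  have h : (η : E →ₗ[ℝ] ℝ) ((Module.evalEquiv ℝ E).symm ℓ) = ℓ (η : E →ₗ[ℝ] ℝ) :=
    Module.apply_evalEquiv_symm_apply ℝ E (η : E →ₗ[ℝ] ℝ) ℓ
  rw [ContinuousLinearMap.coe_coe] at h
  rw [h]
  change _ = P ![ξ, LinearMap.toContinuousLinearMap (η : E →ₗ[ℝ] ℝ)]
  congr 3

/-! ### Differentiation of a bivector field paired with varying covectors. -/

variable {H : Type*} [NormedAddCommGroup H] [NormedSpace ℝ H]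

/-- The Leibniz rule for the trilinear pairing. The existential keeps the derivative opaque, so that
differentiability and the explicit formula can be extracted separately. -/
theorem Bivector.exists_hasFDerivAt_pairing {p : H → Bivector E} {a b : H → E →L[ℝ] ℝ} {w : H}
    (hp : DifferentiableAt ℝ p w) (ha : DifferentiableAt ℝ a w) (hb : DifferentiableAt ℝ b w) :
    ∃ L : H →L[ℝ] ℝ, HasFDerivAt (fun v => p v ![a v, b v]) L w ∧
      ∀ h, L h = fderiv ℝ p w h ![a w, b w] + p w ![fderiv ℝ a w h, b w]
        + p w ![a w, fderiv ℝ b w h] := by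
  have h := hp.hasFDerivAt.continuousAlternatingMap_apply
    (g := fun (i : Fin 2) v => (![a v, b v] : Fin 2 → E →L[ℝ] ℝ) i)
    (g' := ![fderiv ℝ a w, fderiv ℝ b w])
    (fun i => by fin_cases i; exacts [ha.hasFDerivAt, hb.hasFDerivAt])
  refine ⟨_, h, fun v => ?_⟩
  have u0 : ∀ ζ, Function.update (fun i => (![a w, b w] : Fin 2 → E →L[ℝ] ℝ) i) 0 ζ
      = ![ζ, b w] := fun ζ => by ext i; fin_cases i <;> rfl
  have u1 : ∀ ζ, Function.update (fun i => (![a w, b w] : Fin 2 → E →L[ℝ] ℝ) i) 1 ζ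
      = ![a w, ζ] := fun ζ => by ext i; fin_cases i <;> rfl
  simp [Fin.sum_univ_two, u0, u1, add_assoc]

theorem Bivector.differentiableAt_pairing {p : H → Bivector E} {a b : H → E →L[ℝ] ℝ} {w : H}
    (hp : DifferentiableAt ℝ p w) (ha : DifferentiableAt ℝ a w) (hb : DifferentiableAt ℝ b w) :
    DifferentiableAt ℝ (fun v => p v ![a v, b v]) w :=
  let ⟨_, h, _⟩ := Bivector.exists_hasFDerivAt_pairing hp ha hb
  h.differentiableAt

theorem Bivector.fderiv_pairing {p : H → Bivector E} {a b : H → E →L[ℝ] ℝ} {w : H}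
    (hp : DifferentiableAt ℝ p w) (ha : DifferentiableAt ℝ a w) (hb : DifferentiableAt ℝ b w)
    (h : H) :
    fderiv ℝ (fun v => p v ![a v, b v]) w h = fderiv ℝ p w h ![a w, b w]
      + p w ![fderiv ℝ a w h, b w] + p w ![a w, fderiv ℝ b w h] := by
  obtain ⟨L, hL, hL'⟩ := Bivector.exists_hasFDerivAt_pairing hp ha hb
  rw [hL.fderiv, hL']

theorem Bivector.fderiv_pairing_const {p : H → Bivector E} {w : H}
    (hp : DifferentiableAt ℝ p w) (ξ η : E →L[ℝ] ℝ) (h : H) :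
    fderiv ℝ (fun v => p v ![ξ, η]) w h = fderiv ℝ p w h ![ξ, η] := by
  rw [Bivector.fderiv_pairing hp (differentiableAt_const _) (differentiableAt_const _)]
  have h0 : ∀ ζ, p w ![0, ζ] = 0 := fun ζ => by
    simpa using (p w).apply_smul_left 0 0 ζ
  have h1 : ∀ ζ, p w ![ζ, 0] = 0 := fun ζ => by
    simpa using (p w).apply_smul_right 0 ζ 0
  simp [h0, h1]

/-- The Lie derivative of the bivector field `p` along `X`, evaluated on two covectors. -/
def lieForm (X : E → E) (p : E → Bivector E) (w : E) (ξ η : E →L[ℝ] ℝ) : ℝ :=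
  fderiv ℝ p w (X w) ![ξ, η] - (p w ![ξ.comp (fderiv ℝ X w), η] + p w ![ξ, η.comp (fderiv ℝ X w)])

/-- Half of the Schouten bracket `[p, p]`, evaluated on three covectors. -/
def schoutenForm (p : E → Bivector E) (w : E) (b : Fin 3 → E →L[ℝ] ℝ) : ℝ :=
  ∑ i : Fin 3, p w ![b i, fderiv ℝ (fun v => p v ![b (i + 1), b (i + 2)]) w]

/-! ### Naturality of the Lie derivative and of the Schouten bracket. -/

variable {φ : E → E} {w : E} {p q : E → Bivector E} {X Y : E → E}

theorem differentiableAt_fderiv_comp (hφ : ContDiffAt ℝ ω φ w) (ξ : E →L[ℝ] ℝ) :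
    DifferentiableAt ℝ (fun v => ξ.comp (fderiv ℝ φ v)) w ∧
      ∀ h, fderiv ℝ (fun v => ξ.comp (fderiv ℝ φ v)) w h
        = ξ.comp (fderiv ℝ (fderiv ℝ φ) w h) := by
  have hA : DifferentiableAt ℝ (fderiv ℝ φ) w :=
    (hφ.fderiv_right (m := 1) (by simp)).differentiableAt one_ne_zero
  have := (ContinuousLinearMap.compL ℝ E E ℝ ξ).hasFDerivAt.comp w hA.hasFDerivAt
  exact ⟨this.differentiableAt, fun h => by
    rw [show (fun v => ξ.comp (fderiv ℝ φ v))
      = (ContinuousLinearMap.compL ℝ E E ℝ ξ) ∘ fderiv ℝ φ from rfl, this.fderiv]; rfl⟩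

/-- The derivative of the push-forward of a bivector field. -/
theorem fderiv_pushforward_bivector (hφ : ContDiffAt ℝ ω φ w) (hp : DifferentiableAt ℝ p w)
    (hq : DifferentiableAt ℝ q (φ w))
    (hqp : ∀ᶠ v in 𝓝 w, q (φ v) = Bivector.map (fderiv ℝ φ v) (p v))
    (ξ η : E →L[ℝ] ℝ) (h : E) :
    fderiv ℝ q (φ w) (fderiv ℝ φ w h) ![ξ, η]
      = fderiv ℝ p w h ![ξ.comp (fderiv ℝ φ w), η.comp (fderiv ℝ φ w)]
        + p w ![ξ.comp (fderiv ℝ (fderiv ℝ φ) w h), η.comp (fderiv ℝ φ w)]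
        + p w ![ξ.comp (fderiv ℝ φ w), η.comp (fderiv ℝ (fderiv ℝ φ) w h)] := by
  have h1 : (fun v => (q ∘ φ) v ![ξ, η]) =ᶠ[𝓝 w]
      fun v => p v ![ξ.comp (fderiv ℝ φ v), η.comp (fderiv ℝ φ v)] := by
    filter_upwards [hqp] with v hv
    rw [Function.comp_apply, hv, Bivector.map_apply]
  have hφ' := hφ.differentiableAt (n := ω) (by simp)
  have h2 := DFunLike.congr_fun (h1.fderiv_eq (𝕜 := ℝ)) h
  obtain ⟨dξ, eξ⟩ := differentiableAt_fderiv_comp hφ ξ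
  obtain ⟨dη, eη⟩ := differentiableAt_fderiv_comp hφ η
  have hqφ : DifferentiableAt ℝ (q ∘ φ) w := 
    DifferentiableAt.comp (G := Bivector E) (g := q) w hq hφ'
  rw [Bivector.fderiv_pairing_const hqφ, Bivector.fderiv_pairing hp dξ dη, eξ, eη,
    fderiv_comp (G := Bivector E) (g := q) w hq hφ'] at h2
  exact h2

/-- Differentiating `q` produces two terms in the second derivative of `φ` along `X`, and
differentiating `Y` produces the same two. They enter `lieForm` with opposite signs and cancel. No
inverse of `φ` is needed, because the covectors are pulled back. -/
theorem lieForm_pushforward (hφ : ContDiffAt ℝ ω φ w) (hp : DifferentiableAt ℝ p w)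
    (hX : DifferentiableAt ℝ X w) (hq : DifferentiableAt ℝ q (φ w))
    (hY : DifferentiableAt ℝ Y (φ w))
    (hqp : ∀ᶠ v in 𝓝 w, q (φ v) = Bivector.map (fderiv ℝ φ v) (p v))
    (hYX : ∀ᶠ v in 𝓝 w, Y (φ v) = fderiv ℝ φ v (X v)) (ξ η : E →L[ℝ] ℝ) :
    lieForm Y q (φ w) ξ η
      = lieForm X p w (ξ.comp (fderiv ℝ φ w)) (η.comp (fderiv ℝ φ w)) := by
  have hφ' := hφ.differentiableAt (n := ω) (by simp)
  have hA : DifferentiableAt ℝ (fderiv ℝ φ) w :=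
    (hφ.fderiv_right (m := 1) (by simp)).differentiableAt one_ne_zero
  have hsymm : IsSymmSndFDerivAt ℝ φ w := hφ.isSymmSndFDerivAt_of_omega
  -- Chain rule for `Y ∘ φ`; symmetry of the second derivative puts `X w` in the first slot, to
  -- match the terms from `q`.
  have hDY : (fderiv ℝ Y (φ w)).comp (fderiv ℝ φ w)
      = (fderiv ℝ φ w).comp (fderiv ℝ X w) + fderiv ℝ (fderiv ℝ φ) w (X w) := by
    have h1 : (Y ∘ φ) =ᶠ[𝓝 w] fun v => fderiv ℝ φ v (X v) := hYX
    have h2 := h1.fderiv_eq (𝕜 := ℝ)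
    rw [fderiv_comp w hY hφ', fderiv_clm_apply hA hX] at h2
    rw [h2]
    ext h
    simp [hsymm.eq h (X w)]
  have e : ∀ ζ : E →L[ℝ] ℝ, (ζ.comp (fderiv ℝ Y (φ w))).comp (fderiv ℝ φ w)
      = (ζ.comp (fderiv ℝ φ w)).comp (fderiv ℝ X w)
        + ζ.comp (fderiv ℝ (fderiv ℝ φ) w (X w)) := fun ζ => by
    rw [ContinuousLinearMap.comp_assoc, hDY, ContinuousLinearMap.comp_add,
      ContinuousLinearMap.comp_assoc]
  unfold lieForm
  rw [hYX.self_of_nhds, fderiv_pushforward_bivector hφ hp hq hqp, hqp.self_of_nhds,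
    Bivector.map_apply, Bivector.map_apply, e, e, Bivector.apply_add_left,
    Bivector.apply_add_right]
  ring

/-- Let `v i` be the contraction of `p` with the pulled-back covector `b i`. Each summand acquires
two correction terms of the form `b j (D²φ(v i, v k))`; in the cyclic sum these cancel in pairs,
because `D²φ` is symmetric. -/
theorem schoutenForm_pushforward [FiniteDimensional ℝ E] (hφ : ContDiffAt ℝ ω φ w)
    (hp : DifferentiableAt ℝ p w) (hq : DifferentiableAt ℝ q (φ w))
    (hqp : ∀ᶠ v in 𝓝 w, q (φ v) = Bivector.map (fderiv ℝ φ v) (p v))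
    (b : Fin 3 → E →L[ℝ] ℝ) :
    schoutenForm q (φ w) b = schoutenForm p w (fun i => (b i).comp (fderiv ℝ φ w)) := by
  have hsymm : IsSymmSndFDerivAt ℝ φ w := hφ.isSymmSndFDerivAt_of_omega
  choose v hv using fun i => (p w).exists_contraction ((b i).comp (fderiv ℝ φ w))
  have key : ∀ i j k, q (φ w) ![b i, fderiv ℝ (fun v => q v ![b j, b k]) (φ w)]
      = p w ![(b i).comp (fderiv ℝ φ w), fderiv ℝ (fun v =>
          p v ![(b j).comp (fderiv ℝ φ w), (b k).comp (fderiv ℝ φ w)]) w]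
        - b j (fderiv ℝ (fderiv ℝ φ) w (v i) (v k))
        + b k (fderiv ℝ (fderiv ℝ φ) w (v i) (v j)) := by
    intro i j k
    rw [hqp.self_of_nhds, Bivector.map_apply, hv, hv, ContinuousLinearMap.comp_apply,
      Bivector.fderiv_pairing_const hq, fderiv_pushforward_bivector hφ hp hq hqp,
      Bivector.fderiv_pairing_const hp, Bivector.swap_apply (p w) ((b k).comp (fderiv ℝ φ w)), hv, hv]
    simp only [ContinuousLinearMap.comp_apply]
    ring
  unfold schoutenForm
  rw [Fin.sum_univ_three, Fin.sum_univ_three, key, key, key]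
  have e1 : (1 : Fin 3) + 1 = 2 := rfl
  have e2 : (1 : Fin 3) + 2 = 0 := rfl
  have e3 : (2 : Fin 3) + 1 = 0 := rfl
  have e4 : (2 : Fin 3) + 2 = 1 := rfl
  simp only [zero_add, e1, e2, e3, e4]
  rw [hsymm.eq (v 2) (v 1), hsymm.eq (v 1) (v 0), hsymm.eq (v 2) (v 0)]
  ring

/-- A map whose composition with a local diffeomorphism is differentiable is differentiable. -/
theorem differentiableAt_of_comp {F' : Type*} [NormedAddCommGroup F'] [NormedSpace ℝ F']
    {f g : E → F'} {θ : E → E} (hg : DifferentiableAt ℝ g w)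
    (hθ : DifferentiableAt ℝ θ (φ w)) (hφθ : ∀ᶠ v in 𝓝 (φ w), φ (θ v) = v)
    (hθφ : θ (φ w) = w) (hfg : ∀ᶠ v in 𝓝 w, f (φ v) = g v) : DifferentiableAt ℝ f (φ w) := by
  have h1 : DifferentiableAt ℝ (g ∘ θ) (φ w) := DifferentiableAt.comp _ (by rwa [hθφ]) hθ
  refine h1.congr_of_eventuallyEq ?_
  have h2 : Tendsto θ (𝓝 (φ w)) (𝓝 w) := by
    have := hθ.continuousAt.tendsto
    rwa [hθφ] at this
  filter_upwards [hφθ, h2.eventually hfg] with v h3 h4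
  rw [Function.comp_apply, ← h4, h3]

/-- A product of two factors that vanish at a point has zero derivative there. -/
theorem hasFDerivAt_bilin_zero {V W : Type*} [NormedAddCommGroup V] [NormedSpace ℝ V]
    [FiniteDimensional ℝ V] [NormedAddCommGroup W] [NormedSpace ℝ W] [FiniteDimensional ℝ W]
    {N : Type*} [NormedAddCommGroup N] [NormedSpace ℝ N]
    (T : V →ₗ[ℝ] W →ₗ[ℝ] N) {u : E → V} {v : E → W}
    (hu : DifferentiableAt ℝ u w) (hv : DifferentiableAt ℝ v w) (hu0 : u w = 0) (hv0 : v w = 0) :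
    HasFDerivAt (fun z => T (u z) (v z)) (0 : E →L[ℝ] N) w := by
  let T' : V →L[ℝ] W →L[ℝ] N := LinearMap.toContinuousLinearMap
    ((LinearMap.toContinuousLinearMap : (W →ₗ[ℝ] N) ≃ₗ[ℝ] _).toLinearMap ∘ₗ T)
  have h := (T'.hasFDerivAt.comp w hu.hasFDerivAt).clm_apply hv.hasFDerivAt
  convert! h using 1
  ext z
  simp [hu0, hv0]

end Coordinates

/-! ### Change of charts -/

section Charts

variable {E : Type*} [NormedAddCommGroup E] [NormedSpace ℝ E]
  {B : Type*} [TopologicalSpace B] [ChartedSpace E B]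

/-- The derivative at `a` of the preferred chart at `c`, as a map of `E`. -/
def chartDeriv (c a : B) : E →L[ℝ] E := mfderiv 𝓘(ℝ, E) 𝓘(ℝ, E) (extChartAt 𝓘(ℝ, E) c) a

/-- The transition map from the preferred chart at `c` to the preferred chart at `a`. -/
def transition (c a : B) (v : E) : E :=
  extChartAt 𝓘(ℝ, E) a ((extChartAt 𝓘(ℝ, E) c).symm v)

/-- The cotangent vector at `a` with coordinates `ξ` in the preferred chart at `c`. -/
def chartCovector (c a : B) (ξ : E →L[ℝ] ℝ) : TangentSpace 𝓘(ℝ, E) a →L[ℝ] ℝ :=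
  (ξ.comp (chartDeriv (E := E) c a) : E →L[ℝ] ℝ)

variable {c a : B}

theorem Bivector.map_comp (A C : E →L[ℝ] E) (P : Bivector E) :
    Bivector.map (A.comp C) P = Bivector.map A (Bivector.map C P) := by
  refine Bivector.ext_pair fun ξ η => ?_
  rw [Bivector.map_apply, Bivector.map_apply, Bivector.map_apply]
  rfl

theorem eventually_symm_mem_source {b : B} (hc : b ∈ (extChartAt 𝓘(ℝ, E) c).source) {s : Set B}
    (hs : s ∈ 𝓝 b) : ∀ᶠ v in 𝓝 (extChartAt 𝓘(ℝ, E) c b), (extChartAt 𝓘(ℝ, E) c).symm v ∈ s := by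
  have h := continuousAt_extChartAt_symm' (I := 𝓘(ℝ, E)) hc
  have h' := h.tendsto
  rw [(extChartAt 𝓘(ℝ, E) c).left_inv hc] at h'
  exact h' hs

theorem eventually_mem_target {b : B} (hc : b ∈ (extChartAt 𝓘(ℝ, E) c).source) :
    ∀ᶠ v in 𝓝 (extChartAt 𝓘(ℝ, E) c b), v ∈ (extChartAt 𝓘(ℝ, E) c).target :=
  extChartAt_target_mem_nhds' ((extChartAt 𝓘(ℝ, E) c).map_source hc)

theorem transition_apply (ha : a ∈ (extChartAt 𝓘(ℝ, E) c).source) :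
    transition c a (extChartAt 𝓘(ℝ, E) c a) = extChartAt 𝓘(ℝ, E) a a := by
  rw [transition, (extChartAt 𝓘(ℝ, E) c).left_inv ha]

variable [IsManifold 𝓘(ℝ, E) ω B]

theorem chartDeriv_self (a : B) : chartDeriv a a = ContinuousLinearMap.id ℝ E :=
  have : IsManifold 𝓘(ℝ, E) 1 B := IsManifold.of_le (n := ω) (by simp)
  mfderiv_extChartAt_self

theorem contDiffAt_transition {b : B} (hc : b ∈ (extChartAt 𝓘(ℝ, E) c).source)
    (ha : b ∈ (extChartAt 𝓘(ℝ, E) a).source) :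
    ContDiffAt ℝ ω (transition c a) (extChartAt 𝓘(ℝ, E) c b) := by
  have h := contDiffWithinAt_ext_coord_change (I := 𝓘(ℝ, E)) (n := ω) a c
    (y := extChartAt 𝓘(ℝ, E) c b) (by
      rw [PartialEquiv.trans_source]
      refine ⟨(extChartAt 𝓘(ℝ, E) c).map_source hc, ?_⟩
      rw [Set.mem_preimage, (extChartAt 𝓘(ℝ, E) c).left_inv hc]
      exact ha)
  rwa [modelWithCornersSelf_coe, Set.range_id, contDiffWithinAt_univ] at h

/-- Chain rule: near `b`, the chart at `a` is the transition map after the chart at `c`. -/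
theorem chartDeriv_eq_comp {b : B} (hc : b ∈ (extChartAt 𝓘(ℝ, E) c).source)
    (ha : b ∈ (extChartAt 𝓘(ℝ, E) a).source) :
    chartDeriv a b
      = (fderiv ℝ (transition c a) (extChartAt 𝓘(ℝ, E) c b)).comp (chartDeriv c b) := by
  have : IsManifold 𝓘(ℝ, E) 1 B := IsManifold.of_le (n := ω) (by simp)
  have h1 : (extChartAt 𝓘(ℝ, E) a : B → E)
      =ᶠ[𝓝 b] transition c a ∘ extChartAt 𝓘(ℝ, E) c := by
    filter_upwards [extChartAt_source_mem_nhds' hc] with z hz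
    simp only [Function.comp_apply, transition, (extChartAt 𝓘(ℝ, E) c).left_inv hz]
  have h2 : MDifferentiableAt 𝓘(ℝ, E) 𝓘(ℝ, E) (transition c a) (extChartAt 𝓘(ℝ, E) c b) :=
    ((contDiffAt_transition hc ha).differentiableAt (n := ω) (by simp)).mdifferentiableAt
  have h3 : MDifferentiableAt 𝓘(ℝ, E) 𝓘(ℝ, E) (extChartAt 𝓘(ℝ, E) c) b :=
    mdifferentiableAt_extChartAt (by rwa [← extChartAt_source 𝓘(ℝ, E)])
  have h4 := h1.mfderiv_eq (I := 𝓘(ℝ, E)) (I' := 𝓘(ℝ, E))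
  rw [mfderiv_comp b h2 h3, mfderiv_eq_fderiv] at h4
  exact h4

/-- The pushforward lemmas differentiate the relation between the two coordinate expressions, so it
is needed on a neighbourhood and not only at `a`. -/
theorem eventually_chartDeriv_eq_comp (ha : a ∈ (extChartAt 𝓘(ℝ, E) c).source) :
    ∀ᶠ v in 𝓝 (extChartAt 𝓘(ℝ, E) c a),
      (extChartAt 𝓘(ℝ, E) a).symm (transition c a v) = (extChartAt 𝓘(ℝ, E) c).symm v ∧
      chartDeriv a ((extChartAt 𝓘(ℝ, E) c).symm v)
        = (fderiv ℝ (transition c a) v).comp (chartDeriv c ((extChartAt 𝓘(ℝ, E) c).symm v)) := by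
  filter_upwards [eventually_symm_mem_source ha (extChartAt_source_mem_nhds (I := 𝓘(ℝ, E)) a),
    eventually_mem_target ha] with v h1 h2
  refine ⟨(extChartAt 𝓘(ℝ, E) a).left_inv h1, ?_⟩
  have := chartDeriv_eq_comp ((extChartAt 𝓘(ℝ, E) c).map_target h2) h1
  rwa [(extChartAt 𝓘(ℝ, E) c).right_inv h2] at this

variable {X : ∀ z : B, TangentSpace 𝓘(ℝ, E) z}
  {P : ∀ z : B, Bivector (TangentSpace 𝓘(ℝ, E) z)}

theorem eventually_vectorFieldInChart (ha : a ∈ (extChartAt 𝓘(ℝ, E) c).source) :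
    ∀ᶠ v in 𝓝 (extChartAt 𝓘(ℝ, E) c a), vectorFieldInChart X a (transition c a v)
      = fderiv ℝ (transition c a) v (vectorFieldInChart X c v) := by
  filter_upwards [eventually_chartDeriv_eq_comp ha] with v hv
  change chartDeriv (E := E) a _ (X _ : E) = _
  rw [hv.1, hv.2]
  rfl

theorem eventually_bivectorFieldInChart (ha : a ∈ (extChartAt 𝓘(ℝ, E) c).source) :
    ∀ᶠ v in 𝓝 (extChartAt 𝓘(ℝ, E) c a), bivectorFieldInChart P a (transition c a v)
      = Bivector.map (fderiv ℝ (transition c a) v) (bivectorFieldInChart P c v) := by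
  filter_upwards [eventually_chartDeriv_eq_comp ha] with v hv
  change Bivector.map (chartDeriv (E := E) a _) (P _ : Bivector E)
    = Bivector.map _ (Bivector.map (chartDeriv (E := E) c _) (P _ : Bivector E))
  rw [hv.1, hv.2]
  exact Bivector.map_comp _ _ _

/-- Near `a` the transition map has the reverse transition as a differentiable inverse, so
differentiability passes from the chart at `c` to the chart at `a`. -/
theorem differentiableAt_transport {F' : Type*} [NormedAddCommGroup F'] [NormedSpace ℝ F']
    (ha : a ∈ (extChartAt 𝓘(ℝ, E) c).source) {f g : E → F'}
    (hg : DifferentiableAt ℝ g (extChartAt 𝓘(ℝ, E) c a))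
    (hfg : ∀ᶠ v in 𝓝 (extChartAt 𝓘(ℝ, E) c a), f (transition c a v) = g v) :
    DifferentiableAt ℝ f (transition c a (extChartAt 𝓘(ℝ, E) c a)) := by
  have haa := mem_extChartAt_source (I := 𝓘(ℝ, E)) a
  refine differentiableAt_of_comp (θ := transition a c) hg ?_ ?_ ?_ hfg
  · rw [transition_apply ha]
    exact (contDiffAt_transition haa ha).differentiableAt (n := ω) (by simp)
  · rw [transition_apply ha]
    filter_upwards [eventually_symm_mem_source haa (extChartAt_source_mem_nhds' ha),
      eventually_mem_target haa] with v h1 h2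
    rw [transition, transition, (extChartAt 𝓘(ℝ, E) c).left_inv h1,
      (extChartAt 𝓘(ℝ, E) a).right_inv h2]
  · rw [transition_apply ha, transition, (extChartAt 𝓘(ℝ, E) a).left_inv haa]

/-- The chart at `a` has identity derivative at `a`, so `chartDeriv c a` is the derivative of the
transition from `a` to `c`, inverse to that from `c` to `a`. -/
theorem chartDeriv_comp_fderiv_transition (ha : a ∈ (extChartAt 𝓘(ℝ, E) c).source) :
    (chartDeriv c a).comp (fderiv ℝ (transition c a) (extChartAt 𝓘(ℝ, E) c a))
      = ContinuousLinearMap.id ℝ E := by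
  have haa := mem_extChartAt_source (I := 𝓘(ℝ, E)) a
  have h1 := chartDeriv_eq_comp haa ha
  have h2 : transition a c ∘ transition c a =ᶠ[𝓝 (extChartAt 𝓘(ℝ, E) c a)] id := by
    filter_upwards [eventually_chartDeriv_eq_comp ha, eventually_mem_target ha] with v h1 h2
    rw [Function.comp_apply, transition, h1.1, (extChartAt 𝓘(ℝ, E) c).right_inv h2, id]
  have h3 := (contDiffAt_transition ha haa).differentiableAt (n := ω) (by simp)
  have h4 := (contDiffAt_transition haa ha).differentiableAt (n := ω) (by simp)
  have h5 := h2.fderiv_eq (𝕜 := ℝ)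
  rw [fderiv_comp _ (by rwa [transition_apply ha]) h3, transition_apply ha, fderiv_id] at h5
  rw [h1, chartDeriv_self, ContinuousLinearMap.comp_id]
  exact h5

/-- The Lie derivative at `a`, computed in the preferred chart at another point. -/
theorem lieDerivBivector_eq_lieForm (ha : a ∈ (extChartAt 𝓘(ℝ, E) c).source)
    (hX : DifferentiableAt ℝ (vectorFieldInChart X c) (extChartAt 𝓘(ℝ, E) c a))
    (hPa : SmoothBivectorFieldAt P a)
    (hP : DifferentiableAt ℝ (bivectorFieldInChart P c) (extChartAt 𝓘(ℝ, E) c a))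
    (ξ η : E →L[ℝ] ℝ) :
    lieDerivBivector X P a ![chartCovector c a ξ, chartCovector c a η]
      = lieForm (vectorFieldInChart X c) (bivectorFieldInChart P c) (extChartAt 𝓘(ℝ, E) c a)
        ξ η := by
  have haa := mem_extChartAt_source (I := 𝓘(ℝ, E)) a
  have hφ := contDiffAt_transition ha haa
  have hX' := eventually_vectorFieldInChart (X := X) ha
  have hP' := eventually_bivectorFieldInChart (P := P) ha
  have dA : DifferentiableAt ℝ (fderiv ℝ (transition c a)) (extChartAt 𝓘(ℝ, E) c a) :=
    (hφ.fderiv_right (m := 1) (by simp)).differentiableAt one_ne_zero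
  have dX := differentiableAt_transport ha (dA.clm_apply hX) hX'
  have dP : DifferentiableAt ℝ (bivectorFieldInChart P a)
      (transition c a (extChartAt 𝓘(ℝ, E) c a)) := by
    rw [transition_apply ha]
    exact ContDiffAt.differentiableAt hPa (by simp)
  -- These covectors are chosen so that their pullbacks along the transition map are `ξ` and `η`.
  have h := lieForm_pushforward hφ hP hX dP dX hP' hX' (ξ.comp (chartDeriv c a))
    (η.comp (chartDeriv c a))
  rw [ContinuousLinearMap.comp_assoc, ContinuousLinearMap.comp_assoc,
    chartDeriv_comp_fderiv_transition ha, ContinuousLinearMap.comp_id,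
    ContinuousLinearMap.comp_id, transition_apply ha] at h
  rw [← h, lieForm, ← Bivector.derivation_apply]
  rfl

/-- The factor 2 arises because the two summands of the bracket coincide when both arguments are
`P`. -/
theorem schoutenBracket_eq_schoutenForm [FiniteDimensional ℝ E]
    (ha : a ∈ (extChartAt 𝓘(ℝ, E) c).source)
    (hPa : SmoothBivectorFieldAt P a)
    (hP : DifferentiableAt ℝ (bivectorFieldInChart P c) (extChartAt 𝓘(ℝ, E) c a)) (s : ℤˣ)
    (b : Fin 3 → E →L[ℝ] ℝ) :
    schoutenBracket s P P a (fun i => chartCovector c a (b i))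
      = ((s : ℤ) : ℝ) * (2 * schoutenForm (bivectorFieldInChart P c) (extChartAt 𝓘(ℝ, E) c a) b)
        := by
  have haa := mem_extChartAt_source (I := 𝓘(ℝ, E)) a
  have hφ := contDiffAt_transition ha haa
  have hP' := eventually_bivectorFieldInChart (P := P) ha
  have dP : DifferentiableAt ℝ (bivectorFieldInChart P a)
      (transition c a (extChartAt 𝓘(ℝ, E) c a)) := by
    rw [transition_apply ha]
    exact ContDiffAt.differentiableAt hPa (by simp)
  have h := schoutenForm_pushforward hφ hP dP hP' (fun i => (b i).comp (chartDeriv c a))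
  simp only [ContinuousLinearMap.comp_assoc, chartDeriv_comp_fderiv_transition ha,
    ContinuousLinearMap.comp_id, transition_apply ha] at h
  rw [← h, schoutenForm, Finset.mul_sum]
  refine congrArg _ (Finset.sum_congr rfl fun i _ => ?_)
  exact (two_mul _).symm

end Charts

/-! ### Partial derivatives of a map of two variables at a fixed point -/

section PartialDerivatives

variable {E : Type*} [NormedAddCommGroup E] [NormedSpace ℝ E]
  {B : Type*} [TopologicalSpace B] [ChartedSpace E B]
  {F : Type*} [NormedAddCommGroup F] [NormedSpace ℝ F]
  {M : Type*} [TopologicalSpace M] [ChartedSpace F M]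

/-- The derivative at `q` of `b ↦ f a b`, as a linear map between the model spaces. -/
def rightDeriv (f : B → M → B) (a : B) (q : M) : F →L[ℝ] E :=
  mfderiv 𝓘(ℝ, F) 𝓘(ℝ, E) (fun b => f a b) q

/-- The derivative of `f` in the second variable at `q`, in the preferred charts at `c`
and `q`, as a function of the first variable. -/
def partialDeriv (f : B → M → B) (c : B) (q : M) (u : E) : F →L[ℝ] E :=
  fderiv ℝ (fun v : F => extChartAt 𝓘(ℝ, E) c
    (f ((extChartAt 𝓘(ℝ, E) c).symm u) ((extChartAt 𝓘(ℝ, F) q).symm v))) (extChartAt 𝓘(ℝ, F) q q)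

variable {f : B → M → B} {c : B} {q : M}

/-- `mixedDeriv` uses the chart at `f c q` and `partialDeriv` the chart at `c`; the hypothesis
identifies them. -/
theorem mixedDeriv_eq_fderiv_partialDeriv (h : f c q = c) :
    mixedDeriv (E₁ := E) (E₂ := F) (E₃ := E) f c q
      = fderiv ℝ (partialDeriv (E := E) (F := F) f c q) (extChartAt 𝓘(ℝ, E) c c) := by
  unfold mixedDeriv partialDeriv
  rw [h]

/-- Applied to `σ`: an action fixing the base point has infinitesimal generators that vanish there.
-/
theorem partialDeriv_eq_zero (h : ∀ᶠ b in 𝓝 q, f c b = c) :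
    partialDeriv (E := E) (F := F) f c q (extChartAt 𝓘(ℝ, E) c c) = 0 := by
  have h1 : (fun v : F => extChartAt 𝓘(ℝ, E) c (f ((extChartAt 𝓘(ℝ, E) c).symm
      (extChartAt 𝓘(ℝ, E) c c)) ((extChartAt 𝓘(ℝ, F) q).symm v)))
      =ᶠ[𝓝 (extChartAt 𝓘(ℝ, F) q q)] fun _ => extChartAt 𝓘(ℝ, E) c c := by
    filter_upwards [eventually_symm_mem_source (mem_extChartAt_source q) h] with v hv
    rw [extChartAt_to_inv]
    exact congrArg _ hv
  rw [partialDeriv, h1.fderiv_eq, fderiv_const_apply]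

theorem partialDeriv_eq_id {f : B → B → B} (h : ∀ᶠ b in 𝓝 c, f c b = b) :
    partialDeriv f c c (extChartAt 𝓘(ℝ, E) c c) = ContinuousLinearMap.id ℝ E := by
  have hc := mem_extChartAt_source (I := 𝓘(ℝ, E)) c
  have h1 : (fun v : E => extChartAt 𝓘(ℝ, E) c (f ((extChartAt 𝓘(ℝ, E) c).symm
      (extChartAt 𝓘(ℝ, E) c c)) ((extChartAt 𝓘(ℝ, E) c).symm v)))
      =ᶠ[𝓝 (extChartAt 𝓘(ℝ, E) c c)] id := by
    filter_upwards [eventually_symm_mem_source hc h, eventually_mem_target hc] with v hv hv'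
    rw [extChartAt_to_inv]
    exact (congrArg _ hv).trans ((extChartAt 𝓘(ℝ, E) c).right_inv hv')
  rw [partialDeriv, h1.fderiv_eq, fderiv_id]

variable [IsManifold 𝓘(ℝ, E) ω B] [IsManifold 𝓘(ℝ, F) ω M]

theorem contMDiffAt_extChartAt_symm (c : B) :
    ContMDiffAt 𝓘(ℝ, E) 𝓘(ℝ, E) ω (extChartAt 𝓘(ℝ, E) c).symm (extChartAt 𝓘(ℝ, E) c c) :=
  (contMDiffOn_extChartAt_symm c).contMDiffAt (extChartAt_target_mem_nhds c)

theorem contDiffAt_partialDeriv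
    (hf : ContMDiffAt (𝓘(ℝ, E).prod 𝓘(ℝ, F)) 𝓘(ℝ, E) ω (fun p : B × M => f p.1 p.2) (c, q))
    (h : f c q = c) :
    ContDiffAt ℝ ω (partialDeriv (E := E) (F := F) f c q) (extChartAt 𝓘(ℝ, E) c c) := by
  let z : E × F := (extChartAt 𝓘(ℝ, E) c c, extChartAt 𝓘(ℝ, F) q q)
  have h1 : ContMDiffAt 𝓘(ℝ, E × F) (𝓘(ℝ, E).prod 𝓘(ℝ, F)) ω
      (fun p : E × F => ((extChartAt 𝓘(ℝ, E) c).symm p.1, (extChartAt 𝓘(ℝ, F) q).symm p.2)) z := by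
    refine ContMDiffAt.prodMk ?_ ?_
    · exact (contMDiffAt_extChartAt_symm c).comp z contDiff_fst.contMDiff.contMDiffAt
    · exact (contMDiffAt_extChartAt_symm q).comp z contDiff_snd.contMDiff.contMDiffAt
  have h2 : ContMDiffAt 𝓘(ℝ, E) 𝓘(ℝ, E) ω (extChartAt 𝓘(ℝ, E) c) (f c q) := by
    rw [h]
    exact contMDiffAt_extChartAt
  have h3 : ContMDiffAt (𝓘(ℝ, E).prod 𝓘(ℝ, F)) 𝓘(ℝ, E) ω
      (fun p : B × M => extChartAt 𝓘(ℝ, E) c (f p.1 p.2)) (c, q) := h2.comp (c, q) hf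
  have h4 : ContMDiffAt 𝓘(ℝ, E × F) 𝓘(ℝ, E) ω (fun p : E × F => extChartAt 𝓘(ℝ, E) c
      (f ((extChartAt 𝓘(ℝ, E) c).symm p.1) ((extChartAt 𝓘(ℝ, F) q).symm p.2))) z := by
    refine ContMDiffAt.comp z (g := fun p : B × M => extChartAt 𝓘(ℝ, E) c (f p.1 p.2)) ?_ h1
    simpa only [z, extChartAt_to_inv] using! h3
  exact ContDiffAt.fderiv (n := ω) (f := fun (u : E) (v : F) => extChartAt 𝓘(ℝ, E) c
    (f ((extChartAt 𝓘(ℝ, E) c).symm u) ((extChartAt 𝓘(ℝ, F) q).symm v)))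
    h4.contDiffAt contDiffAt_const (by simp)

/-- Links `lam` and `rho`, whose values at `a` are read in the chart at `a`, to their expressions in
the fixed chart at `c`, by the chain rule through that chart. -/
theorem eventually_chartDeriv_comp_rightDeriv
    (hf : ContMDiffAt (𝓘(ℝ, E).prod 𝓘(ℝ, F)) 𝓘(ℝ, E) ω (fun p : B × M => f p.1 p.2) (c, q))
    (h : ∀ᶠ a in 𝓝 c, f a q = a) :
    ∀ᶠ u in 𝓝 (extChartAt 𝓘(ℝ, E) c c),
      (chartDeriv c ((extChartAt 𝓘(ℝ, E) c).symm u)).comp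
        (rightDeriv f ((extChartAt 𝓘(ℝ, E) c).symm u) q)
          = partialDeriv (E := E) (F := F) f c q u := by
  have : IsManifold 𝓘(ℝ, E) 1 B := IsManifold.of_le (n := ω) (by simp)
  have h1 : ∀ᶠ a in 𝓝 c, ContMDiffAt (𝓘(ℝ, E).prod 𝓘(ℝ, F)) 𝓘(ℝ, E) ω
      (fun p : B × M => f p.1 p.2) (a, q) :=
    ((continuous_id.prodMk continuous_const).tendsto c).eventually
      ((contMDiffAt_iff_contMDiffAt_nhds (by simp)).1 hf)
  have hc := mem_extChartAt_source (I := 𝓘(ℝ, E)) c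
  filter_upwards [eventually_symm_mem_source hc h1, eventually_symm_mem_source hc h,
    eventually_symm_mem_source hc (extChartAt_source_mem_nhds (I := 𝓘(ℝ, E)) c)] with u h2 h3 h4
  generalize haa : (extChartAt 𝓘(ℝ, E) c).symm u = a at *
  have h5 : MDifferentiableAt 𝓘(ℝ, F) 𝓘(ℝ, E) (fun b => f a b) q := by
    have h6 : ContMDiffAt 𝓘(ℝ, F) 𝓘(ℝ, E) ω (fun b => f a b) q :=
      ContMDiffAt.comp q (g := fun p : B × M => f p.1 p.2) h2
        (contMDiffAt_const.prodMk contMDiffAt_id)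
    exact h6.mdifferentiableAt (by simp)
  have h7 : MDifferentiableAt 𝓘(ℝ, E) 𝓘(ℝ, E) (extChartAt 𝓘(ℝ, E) c) (f a q) := by
    rw [show f a q = a from h3]
    exact mdifferentiableAt_extChartAt (by rwa [← extChartAt_source 𝓘(ℝ, E)])
  have h8 := mfderiv_comp q h7 h5
  have h9 : mfderiv 𝓘(ℝ, F) 𝓘(ℝ, E) ((extChartAt 𝓘(ℝ, E) c) ∘ fun b => f a b) q
      = partialDeriv (E := E) (F := F) f c q u := by
    refine (MDifferentiableAt.mfderiv (h7.comp q h5)).trans ?_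
    change fderivWithin ℝ (fun v => extChartAt 𝓘(ℝ, E) c (f a ((extChartAt 𝓘(ℝ, F) q).symm v)))
      (Set.range id) _ = _
    rw [Set.range_id, fderivWithin_univ, partialDeriv, haa]
  -- The chain rule places the chart derivative at `f a q`; since `f a q = a`, it may be read at
  -- `a`.
  have h10 : chartDeriv (E := E) c (f a q) = chartDeriv c a := by
    rw [show f a q = a from h3]
  rw [← h10, ← h9]
  exact h8.symm

end PartialDerivatives

/-! ### The first-order consequences of the two differential conditions -/

section FirstOrder

variable {E : Type*} [NormedAddCommGroup E] [NormedSpace ℝ E]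
  {p : E → Bivector E} {y : E}

theorem fderiv_pairing_of_eq_zero (hp : DifferentiableAt ℝ p y) (h0 : p y = 0)
    {a b : E → E →L[ℝ] ℝ} (ha : DifferentiableAt ℝ a y) (hb : DifferentiableAt ℝ b y) (x : E) :
    fderiv ℝ (fun v => p v ![a v, b v]) y x = fderiv ℝ p y x ![a y, b y] := by
  rw [Bivector.fderiv_pairing hp ha hb, h0]
  simp

theorem differentiableAt_fderiv_pairing (hp : ContDiffAt ℝ 2 p y) (ξ η : E →L[ℝ] ℝ) :
    DifferentiableAt ℝ (fderiv ℝ (fun v => p v ![ξ, η])) y := by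
  let ev : Bivector E →L[ℝ] ℝ := ContinuousAlternatingMap.apply ℝ (E →L[ℝ] ℝ) ℝ ![ξ, η]
  have h : ContDiffAt ℝ 2 (fun v => ev (p v)) y :=
    ContDiffAt.comp (g := ev) y ev.contDiff.contDiffAt hp
  exact (h.fderiv_right (m := 1) (by norm_num)).differentiableAt one_ne_zero

/-- If `[p, p]` vanishes to second order at a zero `y` of `p`, then the square of the linearization
of `p` at `y` is zero. -/
theorem cobracketSq_eq_zero_of_schoutenForm (hp : ContDiffAt ℝ 2 p y) (h0 : p y = 0)
    {S : E → ℝ} (b : Fin 3 → E →L[ℝ] ℝ) (hS : HasFDerivAt S (0 : E →L[ℝ] ℝ) y)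
    (h : ∀ᶠ w in 𝓝 y, schoutenForm p w b = S w) (x : E) :
    cobracketSq (fderiv ℝ p y) x (b 0) (b 1) (b 2) = 0 := by
  have hp' : DifferentiableAt ℝ p y := hp.differentiableAt two_ne_zero
  have hd : ∀ i : Fin 3, DifferentiableAt ℝ
      (fun w => p w ![b i, fderiv ℝ (fun v => p v ![b (i + 1), b (i + 2)]) w]) y := fun i =>
    Bivector.differentiableAt_pairing hp' (differentiableAt_const _)
      (differentiableAt_fderiv_pairing hp _ _)
  have h1 : fderiv ℝ (fun w => schoutenForm p w b) y x = 0 := by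
    rw [EventuallyEq.fderiv_eq (h : (fun w => schoutenForm p w b) =ᶠ[𝓝 y] S), hS.fderiv]
    rfl
  have h2 : ∀ i j, fderiv ℝ (fun v => p v ![b i, b j]) y
      = transposeBracket (fderiv ℝ p y) (b i) (b j) := fun i j => by
    ext z
    exact Bivector.fderiv_pairing_const hp' _ _ z
  unfold schoutenForm at h1
  rw [fderiv_fun_sum fun i _ => hd i] at h1
  simp only [sum_apply] at h1
  -- The second derivatives of `p` occur only paired through `p y = 0`, so each summand leaves
  -- `γ(x)(b i, [b j, b k]_γ)`.
  simp only [fderiv_pairing_of_eq_zero hp' h0 (differentiableAt_const _)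
      (differentiableAt_fderiv_pairing hp _ _), h2, Fin.sum_univ_three] at h1
  unfold cobracketSq
  -- `cobracketSq` has the bracket in the first slot and the derivative above has it in the second,
  -- so the two sums are opposite.
  rw [Bivector.swap_apply _ (b 2), Bivector.swap_apply _ (b 0), Bivector.swap_apply _ (b 1)]
  have e1 : (1 : Fin 3) + 1 = 2 := rfl
  have e2 : (1 : Fin 3) + 2 = 0 := rfl
  have e3 : (2 : Fin 3) + 1 = 0 := rfl
  have e4 : (2 : Fin 3) + 2 = 1 := rfl
  simp only [zero_add, e1, e2, e3, e4] at h1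
  linarith

/-- The derivative at a zero `y` of `p` of the condition `L_X p = Λ(γ) + O(2)`, where `X = Λ x`. -/
theorem fderiv_lieForm_condition {Λ : E → E →L[ℝ] E} (hp : ContDiffAt ℝ ∞ p y) (h0 : p y = 0)
    (hΛ : ContDiffAt ℝ ω Λ y) (hΛ1 : Λ y = ContinuousLinearMap.id ℝ E) {S : E → ℝ}
    (hS : HasFDerivAt S (0 : E →L[ℝ] ℝ) y) (x : E) (ξ η : E →L[ℝ] ℝ)
    (h : ∀ᶠ w in 𝓝 y, lieForm (fun v => Λ v x) p w ξ η
      = fderiv ℝ p y x ![ξ.comp (Λ w), η.comp (Λ w)] - S w) (z : E) :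
    fderiv ℝ (fderiv ℝ p) y z x ![ξ, η] + fderiv ℝ p y (fderiv ℝ Λ y z x) ![ξ, η]
      - (fderiv ℝ p y z ![ξ.comp ((fderiv ℝ Λ y).flip x), η]
        + fderiv ℝ p y z ![ξ, η.comp ((fderiv ℝ Λ y).flip x)])
      = fderiv ℝ p y x ![ξ.comp (fderiv ℝ Λ y z), η]
        + fderiv ℝ p y x ![ξ, η.comp (fderiv ℝ Λ y z)] := by
  have hp' : DifferentiableAt ℝ p y := hp.differentiableAt (by simp)
  have hdp : DifferentiableAt ℝ (fderiv ℝ p) y :=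
    (hp.fderiv_right (m := 1) (by norm_cast)).differentiableAt one_ne_zero
  have hΛ' : DifferentiableAt ℝ Λ y := hΛ.differentiableAt (n := ω) (by simp)
  have hX : ContDiffAt ℝ ω (fun v => Λ v x) y := hΛ.clm_apply contDiffAt_const
  have hX' : DifferentiableAt ℝ (fun v => Λ v x) y := hX.differentiableAt (n := ω) (by simp)
  have hDX : fderiv ℝ (fun v => Λ v x) y = (fderiv ℝ Λ y).flip x := by
    ext v
    rw [fderiv_clm_apply hΛ' (differentiableAt_const _)]
    simp
  have d1 : DifferentiableAt ℝ (fun w => fderiv ℝ p w (Λ w x)) y := hdp.clm_apply hX'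
  have hc : ∀ ζ : E →L[ℝ] ℝ, DifferentiableAt ℝ (fun w => ζ.comp (Λ w)) y ∧
      fderiv ℝ (fun w => ζ.comp (Λ w)) y z = ζ.comp (fderiv ℝ Λ y z) := fun ζ => by
    have h1 := (ContinuousLinearMap.compL ℝ E E ℝ ζ).hasFDerivAt.comp y hΛ'.hasFDerivAt
    refine ⟨h1.differentiableAt, ?_⟩
    rw [show (fun w => ζ.comp (Λ w)) = (ContinuousLinearMap.compL ℝ E E ℝ ζ) ∘ Λ from rfl,
      h1.fderiv]
    rfl
  have hcX := differentiableAt_fderiv_comp hX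
  have d2 : DifferentiableAt ℝ (fun w => p w ![ξ.comp (fderiv ℝ (fun v => Λ v x) w), η]) y :=
    Bivector.differentiableAt_pairing hp' (hcX ξ).1 (differentiableAt_const _)
  have d3 : DifferentiableAt ℝ (fun w => p w ![ξ, η.comp (fderiv ℝ (fun v => Λ v x) w)]) y :=
    Bivector.differentiableAt_pairing hp' (differentiableAt_const _) (hcX η).1
  have d4 : DifferentiableAt ℝ (fun w => fderiv ℝ p w (Λ w x) ![ξ, η]) y :=
    Bivector.differentiableAt_pairing d1 (differentiableAt_const _) (differentiableAt_const _)
  have d5 : DifferentiableAt ℝ (fun w => fderiv ℝ p y x ![ξ.comp (Λ w), η.comp (Λ w)]) y :=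
    Bivector.differentiableAt_pairing (differentiableAt_const _) (hc ξ).1 (hc η).1
  have key : fderiv ℝ (fun w => lieForm (fun v => Λ v x) p w ξ η) y z
      = fderiv ℝ (fun w => fderiv ℝ p y x ![ξ.comp (Λ w), η.comp (Λ w)] - S w) y z := by
    rw [EventuallyEq.fderiv_eq h]
  unfold lieForm at key
  rw [fderiv_fun_sub d4 (d2.fun_add d3), fderiv_fun_add d2 d3, fderiv_fun_sub d5 hS.differentiableAt,
    hS.fderiv] at key
  simp only [sub_apply, add_apply, sub_zero] at key
  -- Since `p y = 0`, the second derivatives of `Λ` drop out.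
  rw [fderiv_pairing_of_eq_zero hp' h0 (hcX ξ).1 (differentiableAt_const _),
    fderiv_pairing_of_eq_zero hp' h0 (differentiableAt_const _) (hcX η).1,
    Bivector.fderiv_pairing_const d1, fderiv_clm_apply hdp hX',
    Bivector.fderiv_pairing (differentiableAt_const _) (hc ξ).1 (hc η).1,
    (hc ξ).2, (hc η).2, hDX, hΛ1] at key
  have hz : (0 : Bivector E) ![ξ, η] = 0 := rfl
  simp only [fderiv_const_apply, zero_apply, ContinuousLinearMap.comp_id,
    ContinuousLinearMap.id_apply, add_apply, ContinuousLinearMap.comp_apply,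
    ContinuousLinearMap.flip_apply, ContinuousAlternatingMap.add_apply, hz, zero_add] at key
  linarith

/-- The linearization of `p` is a derivation of the commutator bracket of `Λ`. -/
theorem fderiv_bivector_derivation {Λ : E → E →L[ℝ] E} (hp : ContDiffAt ℝ ∞ p y) (h0 : p y = 0)
    (hΛ : ContDiffAt ℝ ω Λ y) (hΛ1 : Λ y = ContinuousLinearMap.id ℝ E)
    {S : E → (E →L[ℝ] ℝ) → (E →L[ℝ] ℝ) → E → ℝ}
    (hS : ∀ x ξ η, HasFDerivAt (S x ξ η) (0 : E →L[ℝ] ℝ) y)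
    (h : ∀ x ξ η, ∀ᶠ w in 𝓝 y, lieForm (fun v => Λ v x) p w ξ η
      = fderiv ℝ p y x ![ξ.comp (Λ w), η.comp (Λ w)] - S x ξ η w) (x z : E) :
    fderiv ℝ p y ((fderiv ℝ Λ y - (fderiv ℝ Λ y).flip) x z)
      = Bivector.derivation ((fderiv ℝ Λ y - (fderiv ℝ Λ y).flip).flip z) (fderiv ℝ p y x)
        + Bivector.derivation ((fderiv ℝ Λ y - (fderiv ℝ Λ y).flip) x) (fderiv ℝ p y z) := by
  have hsymm : IsSymmSndFDerivAt ℝ p y := hp.isSymmSndFDerivAt (by simp; norm_cast)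
  refine Bivector.ext_pair fun ξ η => ?_
  -- The difference of the two conditions, with `x` and `z` exchanged, no longer contains `D²p`.
  have h1 := fderiv_lieForm_condition hp h0 hΛ hΛ1 (hS x ξ η) x ξ η (h x ξ η) z
  have h2 := fderiv_lieForm_condition hp h0 hΛ hΛ1 (hS z ξ η) z ξ η (h z ξ η) x
  rw [hsymm.eq z x] at h1
  have e1 : (fderiv ℝ Λ y - (fderiv ℝ Λ y).flip).flip z
      = (fderiv ℝ Λ y).flip z - fderiv ℝ Λ y z := by
    ext v
    simp
  have e2 : (fderiv ℝ Λ y - (fderiv ℝ Λ y).flip) x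
      = fderiv ℝ Λ y x - (fderiv ℝ Λ y).flip x := rfl
  have e3 : ∀ (ζ : E →L[ℝ] ℝ) (C D : E →L[ℝ] E), ζ.comp (C - D) = ζ.comp C - ζ.comp D :=
    fun ζ C D => by
      ext v
      simp
  rw [ContinuousAlternatingMap.add_apply, Bivector.derivation_apply, Bivector.derivation_apply,
    e1, e2, sub_apply, ContinuousLinearMap.flip_apply, map_sub,
    ContinuousAlternatingMap.sub_apply]
  simp only [e3, Bivector.apply_sub_left, Bivector.apply_sub_right]
  linarith

end FirstOrder

/-! ### The linearization of the bivector field of a quasi-Poisson Lie quasigroup -/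

namespace QuasiPoissonData

variable {E F B G : Type*}
  [NormedAddCommGroup E] [NormedSpace ℝ E] [FiniteDimensional ℝ E]
  [NormedAddCommGroup F] [NormedSpace ℝ F]
  [TopologicalSpace B] [ChartedSpace E B]
  [TopologicalSpace G] [ChartedSpace F G] [Group G]
  {Q : QuasiPoissonData E F B G} {s : ℤˣ}

/-! ### Reduction to the local case, and vanishing of the `ψ` terms to first order. -/

theorem IsQuasiPoisson.isLocalQuasiPoisson (h : Q.IsQuasiPoisson s) :
    Q.IsLocalQuasiPoisson s where
  loop :=
    { analytic := h.loop.analytic _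
      mul_unit := .of_forall h.loop.mul_unit
      unit_mul := .of_forall h.loop.unit_mul
      left_div := h.loop.left_div.imp fun _ hd => ⟨hd.1 _, .of_forall fun _ => hd.2 _ _ _⟩
      right_div := h.loop.right_div.imp fun _ hd => ⟨hd.1 _, .of_forall fun _ => hd.2 _ _ _⟩ }
  mono := h.mono
  σ_analytic := h.σ_analytic _
  σ_one := .of_forall h.σ_one
  σ_mul := .of_forall fun _ => h.σ_mul _ _ _
  σ_unit := .of_forall h.σ_unit
  α_analytic := h.α_analytic _
  α_unit_left := .of_forall h.α_unit_left
  α_unit_right := .of_forall h.α_unit_right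
  χ_analytic := h.χ_analytic _
  χ_unit := .of_forall h.χ_unit
  χ_one := .of_forall h.χ_one
  χ_twisted := .of_forall fun _ => h.χ_twisted _ _ _
  P_smooth := .of_forall h.P_smooth
  P_unit := h.P_unit
  invariant := h.invariant
  assoc := .of_forall fun _ => h.assoc _ _ _
  cocycle := .of_forall fun _ => h.cocycle _ _ _
  schouten := .of_forall h.schouten
  lieDeriv := .of_forall h.lieDeriv

variable (Q) in
/-- The linear map `R ↦ sharp (ξ ∘ R)`. -/
def sharpComp (ξ : E →L[ℝ] ℝ) : (F →L[ℝ] E) →ₗ[ℝ] E where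
  toFun R := Q.sharp (ξ.comp R : F →L[ℝ] ℝ)
  map_add' R R' := by
    rw [ContinuousLinearMap.comp_add]
    exact map_add Q.pair.flip.toPerfPair.symm _ _
  map_smul' c R := by
    rw [ContinuousLinearMap.comp_smul]
    exact map_smul Q.pair.flip.toPerfPair.symm _ _

variable (Q) in
/-- The pairing as a bilinear map on the model spaces. -/
def modelPair : F →ₗ[ℝ] E →ₗ[ℝ] ℝ := Q.pair

variable (Q) in
/-- The bracket `ψ` as a bilinear map on the model spaces. -/
def modelψ : E →ₗ[ℝ] E →ₗ[ℝ] F := (show E →L[ℝ] E →L[ℝ] F from Q.ψ).toLinearMap₁₂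

section Pairing

variable {R : E → F →L[ℝ] E} {y : E}

theorem sharpComp_eq_zero (hR0 : R y = 0) (ξ : E →L[ℝ] ℝ) : Q.sharpComp ξ (R y) = 0 := by
  rw [hR0, map_zero]

variable [FiniteDimensional ℝ F]

theorem differentiableAt_sharpComp (hR : DifferentiableAt ℝ R y) (ξ : E →L[ℝ] ℝ) :
    DifferentiableAt ℝ (fun w => Q.sharpComp ξ (R w)) y :=
  (LinearMap.toContinuousLinearMap (Q.sharpComp ξ)).differentiableAt.comp y hR

/-- The expression is bilinear in two linear functions of `R`, both zero at `y`. -/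
theorem hasFDerivAt_ψ₂_comp (hR : DifferentiableAt ℝ R y) (hR0 : R y = 0) (x : E)
    (ξ η : E →L[ℝ] ℝ) :
    HasFDerivAt (fun w => Q.ψ₂ x (ξ.comp (R w) : F →L[ℝ] ℝ) (η.comp (R w) : F →L[ℝ] ℝ))
      (0 : E →L[ℝ] ℝ) y :=
  hasFDerivAt_bilin_zero (Q.modelPair ∘ₗ Q.modelψ x) (differentiableAt_sharpComp hR ξ)
    (differentiableAt_sharpComp hR η) (sharpComp_eq_zero hR0 ξ) (sharpComp_eq_zero hR0 η)

theorem hasFDerivAt_ψ₃_comp (hR : DifferentiableAt ℝ R y) (hR0 : R y = 0)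
    (ξ η ζ : E →L[ℝ] ℝ) :
    HasFDerivAt (fun w => Q.ψ₃ (ξ.comp (R w) : F →L[ℝ] ℝ) (η.comp (R w) : F →L[ℝ] ℝ)
      (ζ.comp (R w) : F →L[ℝ] ℝ)) (0 : E →L[ℝ] ℝ) y := by
  -- The cubic term is split as a pairing of `ψ(·, ·)` with a third factor, both differentiable and
  -- zero at `y`.
  have h := hasFDerivAt_bilin_zero Q.modelψ (differentiableAt_sharpComp (Q := Q) hR ξ)
    (differentiableAt_sharpComp (Q := Q) hR η) (sharpComp_eq_zero hR0 ξ)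
    (sharpComp_eq_zero hR0 η)
  refine hasFDerivAt_bilin_zero Q.modelPair h.differentiableAt
    (differentiableAt_sharpComp hR ζ) ?_ (sharpComp_eq_zero hR0 ζ)
  change Q.modelψ (Q.sharpComp ξ (R y)) (Q.sharpComp η (R y)) = 0
  rw [sharpComp_eq_zero hR0, map_zero]
  rfl

end Pairing

/-! ### The structure in the preferred chart at `ε`. -/

variable (Q) in
/-- The bivector field `P` in the preferred chart at `ε`. -/
def localP : E → Bivector E := bivectorFieldInChart Q.P Q.ε

variable (Q) in
/-- The coordinates of `ε`. -/
def base : E := extChartAt 𝓘(ℝ, E) Q.ε Q.ε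

variable (Q) in
/-- `x ↦ x^λ` in the preferred chart at `ε`. -/
def localLam : E → E →L[ℝ] E := partialDeriv Q.m Q.ε Q.ε

variable (Q) in
/-- `ξ ↦ ρ_B(ξ)` in the preferred chart at `ε`. -/
def localRho : E → F →L[ℝ] E := partialDeriv Q.σ Q.ε (1 : G)

theorem contDiffAt_localP (hQ : Q.IsLocalQuasiPoisson s) : ContDiffAt ℝ ∞ Q.localP Q.base :=
  hQ.P_smooth.self_of_nhds

theorem localP_base (hQ : Q.IsLocalQuasiPoisson s) : Q.localP Q.base = 0 := by
  refine Bivector.ext_pair fun ξ η => ?_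
  change Bivector.map (chartDeriv (E := E) Q.ε ((extChartAt 𝓘(ℝ, E) Q.ε).symm
    (extChartAt 𝓘(ℝ, E) Q.ε Q.ε))) (Q.P ((extChartAt 𝓘(ℝ, E) Q.ε).symm
    (extChartAt 𝓘(ℝ, E) Q.ε Q.ε)) : Bivector E) ![ξ, η] = 0
  rw [extChartAt_to_inv, hQ.P_unit]
  rfl

theorem eventually_differentiableAt_localP (hQ : Q.IsLocalQuasiPoisson s) :
    ∀ᶠ w in 𝓝 Q.base, DifferentiableAt ℝ Q.localP w := by
  have h : ContDiffAt ℝ 1 Q.localP Q.base := (contDiffAt_localP hQ).of_le (by norm_cast)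
  filter_upwards [h.eventually (by simp)] with w hw
  exact hw.differentiableAt one_ne_zero

theorem localLam_base (hQ : Q.IsLocalQuasiPoisson s) :
    Q.localLam Q.base = ContinuousLinearMap.id ℝ E :=
  partialDeriv_eq_id hQ.loop.unit_mul

theorem localRho_base (hQ : Q.IsLocalQuasiPoisson s) : Q.localRho Q.base = 0 :=
  partialDeriv_eq_zero hQ.σ_unit

/-- The mixed derivative of `m` is the derivative at `ε` of the frame `Λ`; this is the form in which
`μ` emerges from the Lie derivative condition. -/
theorem μ_eq (hQ : Q.IsLocalQuasiPoisson s) : (Q.μ : E →L[ℝ] E →L[ℝ] E)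
    = fderiv ℝ Q.localLam Q.base - (fderiv ℝ Q.localLam Q.base).flip := by
  have h := mixedDeriv_eq_fderiv_partialDeriv (E := E) (F := E) (f := Q.m)
    hQ.loop.mul_unit.self_of_nhds
  change mixedDeriv Q.m Q.ε Q.ε - (mixedDeriv Q.m Q.ε Q.ε).flip = _
  rw [h]
  rfl

variable [IsManifold 𝓘(ℝ, E) ω B]

theorem contDiffAt_localLam (hQ : Q.IsLocalQuasiPoisson s) : ContDiffAt ℝ ω Q.localLam Q.base :=
  contDiffAt_partialDeriv hQ.loop.analytic hQ.loop.mul_unit.self_of_nhds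

theorem eventually_localLam (hQ : Q.IsLocalQuasiPoisson s) : ∀ᶠ w in 𝓝 Q.base,
    (chartDeriv Q.ε ((extChartAt 𝓘(ℝ, E) Q.ε).symm w)).comp
      (rightDeriv Q.m ((extChartAt 𝓘(ℝ, E) Q.ε).symm w) Q.ε) = Q.localLam w :=
  eventually_chartDeriv_comp_rightDeriv hQ.loop.analytic hQ.loop.mul_unit

theorem eventually_vectorFieldInChart_lamField (hQ : Q.IsLocalQuasiPoisson s) (x : E) :
    vectorFieldInChart (Q.lamField x) Q.ε =ᶠ[𝓝 Q.base] fun w => Q.localLam w x := by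
  filter_upwards [eventually_localLam hQ] with w hw
  rw [← hw]
  rfl

/-- `γ(x) = (L_{x^λ} P)(ε)` is the derivative of `P` at `ε` along `x`, because `P(ε) = 0`. -/
theorem lieDerivBivector_lamField_unit (hQ : Q.IsLocalQuasiPoisson s) (x : E) :
    (lieDerivBivector (Q.lamField x) Q.P Q.ε : Bivector E) = fderiv ℝ Q.localP Q.base x := by
  have hx : vectorFieldInChart (Q.lamField x) Q.ε Q.base = x := by
    rw [(eventually_vectorFieldInChart_lamField hQ x).self_of_nhds]
    exact DFunLike.congr_fun (localLam_base hQ) x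
  refine Bivector.ext_pair (V := E) fun ξ η => ?_
  change fderiv ℝ Q.localP Q.base (vectorFieldInChart (Q.lamField x) Q.ε Q.base) ![ξ, η]
    - Bivector.derivation _ (Q.localP Q.base) ![ξ, η] = _
  rw [hx, localP_base hQ, Bivector.derivation_apply]
  change _ - ((0 : ℝ) + 0) = _
  simp

variable [LieGroup 𝓘(ℝ, F) ω G]

theorem contDiffAt_localRho (hQ : Q.IsLocalQuasiPoisson s) : ContDiffAt ℝ ω Q.localRho Q.base :=
  contDiffAt_partialDeriv hQ.σ_analytic hQ.σ_one.self_of_nhds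

theorem eventually_localRho (hQ : Q.IsLocalQuasiPoisson s) : ∀ᶠ w in 𝓝 Q.base,
    (chartDeriv Q.ε ((extChartAt 𝓘(ℝ, E) Q.ε).symm w)).comp
      (rightDeriv Q.σ ((extChartAt 𝓘(ℝ, E) Q.ε).symm w) (1 : G)) = Q.localRho w :=
  eventually_chartDeriv_comp_rightDeriv hQ.σ_analytic hQ.σ_one

/-- The condition on `L_{x^λ} P` in the preferred chart at `ε`. -/
theorem eventually_lieForm (hQ : Q.IsLocalQuasiPoisson s) (x : E) (ξ η : E →L[ℝ] ℝ) :
    ∀ᶠ w in 𝓝 Q.base,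
    lieForm (fun v => Q.localLam v x) Q.localP w ξ η
      = fderiv ℝ Q.localP Q.base x ![ξ.comp (Q.localLam w), η.comp (Q.localLam w)]
        - Q.ψ₂ x (ξ.comp (Q.localRho w) : F →L[ℝ] ℝ) (η.comp (Q.localRho w) : F →L[ℝ] ℝ) := by
  have hε := mem_extChartAt_source (I := 𝓘(ℝ, E)) Q.ε
  have hX := eventually_vectorFieldInChart_lamField hQ x
  filter_upwards [eventually_localLam hQ, eventually_localRho hQ,
    -- `lieForm` at `w` involves the derivative of the vector field, so the local formula for `x^λ`
    -- must hold on a neighbourhood of `w`.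
    eventually_eventually_nhds.2 hX, eventually_differentiableAt_localP hQ,
    (contDiffAt_localLam hQ).eventually (by simp), eventually_mem_target hε,
    eventually_symm_mem_source hε (hQ.P_smooth.and hQ.lieDeriv)] with w h1 h2 h3 h4 h5 h6 h7
  set a := (extChartAt 𝓘(ℝ, E) Q.ε).symm w with ha
  have haw : extChartAt 𝓘(ℝ, E) Q.ε a = w := (extChartAt 𝓘(ℝ, E) Q.ε).right_inv h6
  have has : a ∈ (extChartAt 𝓘(ℝ, E) Q.ε).source := (extChartAt 𝓘(ℝ, E) Q.ε).map_target h6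
  have h3' : vectorFieldInChart (Q.lamField x) Q.ε =ᶠ[𝓝 w] fun v => Q.localLam v x := h3
  have dX : DifferentiableAt ℝ (fun v => Q.localLam v x) w :=
    (h5.differentiableAt (n := ω) (by simp)).clm_apply (differentiableAt_const _)
  have h8 := lieDerivBivector_eq_lieForm (X := Q.lamField x) (P := Q.P) has
    (by rw [haw]; exact h3'.differentiableAt_iff.2 dX) h7.1 (by rw [haw]; exact h4) ξ η
  rw [haw] at h8
  have h9 : lieForm (vectorFieldInChart (Q.lamField x) Q.ε) Q.localP w ξ η
      = lieForm (fun v => Q.localLam v x) Q.localP w ξ η := by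
    rw [lieForm, lieForm, h3'.fderiv_eq, h3'.self_of_nhds]
  -- The condition at `a` is tested on the covectors with coordinates `ξ`, `η` in the chart at `ε`;
  -- composing them with `lam` and `rho` gives `ξ ∘ Λ`, `ξ ∘ ρ` and likewise for `η`.
  have h10 := h7.2 x (chartCovector Q.ε a ξ) (chartCovector Q.ε a η)
  have h11 : lieForm (fun v => Q.localLam v x) Q.localP w ξ η = _ :=
    h9.symm.trans (h8.symm.trans h10)
  rw [h11, ← h1, ← h2, ← lieDerivBivector_lamField_unit hQ]
  refine congrArg₂ _ ?_ rfl
  exact Bivector.map_apply (V := E) (W := E) (rightDeriv Q.m a Q.ε)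
    (lieDerivBivector (Q.lamField x) Q.P Q.ε : Bivector E)
    (ξ.comp (chartDeriv Q.ε a)) (η.comp (chartDeriv Q.ε a))

/-- The condition on `[P, P]` in the preferred chart at `ε`. -/
theorem eventually_schoutenForm (hQ : Q.IsLocalQuasiPoisson s) (b : Fin 3 → E →L[ℝ] ℝ) :
    ∀ᶠ w in 𝓝 Q.base,
    schoutenForm Q.localP w b
      = -((s : ℤ) : ℝ) * Q.ψ₃ ((b 0).comp (Q.localRho w) : F →L[ℝ] ℝ)
        ((b 1).comp (Q.localRho w) : F →L[ℝ] ℝ) ((b 2).comp (Q.localRho w) : F →L[ℝ] ℝ) := by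
  have hε := mem_extChartAt_source (I := 𝓘(ℝ, E)) Q.ε
  filter_upwards [eventually_localRho hQ, eventually_differentiableAt_localP hQ,
    eventually_mem_target hε,
    eventually_symm_mem_source hε (hQ.P_smooth.and hQ.schouten)] with w h2 h4 h6 h7
  set a := (extChartAt 𝓘(ℝ, E) Q.ε).symm w with ha
  have haw : extChartAt 𝓘(ℝ, E) Q.ε a = w := (extChartAt 𝓘(ℝ, E) Q.ε).right_inv h6
  have has : a ∈ (extChartAt 𝓘(ℝ, E) Q.ε).source := (extChartAt 𝓘(ℝ, E) Q.ε).map_target h6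
  have h8 := schoutenBracket_eq_schoutenForm (P := Q.P) has h7.1 (by rw [haw]; exact h4) s b
  rw [haw] at h8
  have h10 := h7.2 (fun i => chartCovector Q.ε a (b i))
  rw [h8] at h10
  rw [← h2]
  have h11 : (1 / 2 : ℝ) * (((s : ℤ) : ℝ) * (2 * schoutenForm Q.localP w b))
      = - Q.ψ₃ ((b 0).comp ((chartDeriv Q.ε a).comp (rightDeriv Q.σ a (1 : G))) : F →L[ℝ] ℝ)
        ((b 1).comp ((chartDeriv Q.ε a).comp (rightDeriv Q.σ a (1 : G))) : F →L[ℝ] ℝ)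
        ((b 2).comp ((chartDeriv Q.ε a).comp (rightDeriv Q.σ a (1 : G))) : F →L[ℝ] ℝ) := h10
  -- As `s² = 1`, multiplying by `s` solves for `schoutenForm` in either sign convention.
  have hs : ((s : ℤ) : ℝ) * ((s : ℤ) : ℝ) = 1 := by
    rcases Int.units_eq_one_or s with rfl | rfl <;> norm_num
  linear_combination ((s : ℤ) : ℝ) * h11 - schoutenForm Q.localP w b * hs

/-- The linearization of `P` is a cobracket, and a derivation of the bracket `μ`. -/
theorem exists_cobracket [FiniteDimensional ℝ F] (hQ : Q.IsLocalQuasiPoisson s) :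
    ∃ γ : Q.TB →L[ℝ] Bivector Q.TB,
    (∀ x : Q.TB, γ x = lieDerivBivector (Q.lamField x) Q.P Q.ε) ∧
    (∀ (x : Q.TB) (ξ η ζ : Q.TB →L[ℝ] ℝ), cobracketSq γ x ξ η ζ = 0) ∧
    (∀ x y : Q.TB, γ (Q.μ x y) =
      Bivector.derivation (Q.μRight y) (γ x) + Bivector.derivation (Q.μ x) (γ y)) := by
  have hR : DifferentiableAt ℝ Q.localRho Q.base :=
    (contDiffAt_localRho hQ).differentiableAt (n := ω) (by simp)
  have hR0 := localRho_base hQ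
  -- Taking `γ` to be the derivative of `P` in the chart makes its linearity automatic.
  refine ⟨(fderiv ℝ Q.localP Q.base : E →L[ℝ] Bivector E),
    fun x => (lieDerivBivector_lamField_unit hQ x).symm, fun x ξ η ζ => ?_, fun x z => ?_⟩
  · exact cobracketSq_eq_zero_of_schoutenForm
      ((contDiffAt_localP hQ).of_le (by norm_cast)) (localP_base hQ) ![ξ, η, ζ]
      (by simpa using (hasFDerivAt_ψ₃_comp hR hR0 ξ η ζ).const_mul (-((s : ℤ) : ℝ)))
      (eventually_schoutenForm hQ ![ξ, η, ζ]) x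
  · have h := fderiv_bivector_derivation (contDiffAt_localP hQ) (localP_base hQ)
      (contDiffAt_localLam hQ) (localLam_base hQ)
      (fun x ξ η => hasFDerivAt_ψ₂_comp hR hR0 x ξ η) (eventually_lieForm hQ) x z
    rw [← μ_eq hQ] at h
    exact h

end QuasiPoissonData

end

theorem proposition3 {E F B G : Type*}
    [NormedAddCommGroup E] [NormedSpace ℝ E] [FiniteDimensional ℝ E]
    [NormedAddCommGroup F] [NormedSpace ℝ F] [FiniteDimensional ℝ F]
    [TopologicalSpace B] [ChartedSpace E B] [IsManifold 𝓘(ℝ, E) ω B]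
    [TopologicalSpace G] [ChartedSpace F G] [Group G] [LieGroup 𝓘(ℝ, F) ω G]
    (s : ℤˣ) (Q : QuasiPoissonData E F B G)
    (hQ : Q.IsQuasiPoisson s ∨ Q.IsLocalQuasiPoisson s) :
    ∃ γ : Q.TB →L[ℝ] Bivector Q.TB,
      (∀ x : Q.TB, γ x = lieDerivBivector (Q.lamField x) Q.P Q.ε) ∧
      (∀ (x : Q.TB) (ξ η ζ : Q.TB →L[ℝ] ℝ), cobracketSq γ x ξ η ζ = 0) ∧
      (∀ x y : Q.TB, γ (Q.μ x y) =
        Bivector.derivation (Q.μRight y) (γ x) + Bivector.derivation (Q.μ x) (γ y)) := by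
  exact QuasiPoissonData.exists_cobracket
    (hQ.elim QuasiPoissonData.IsQuasiPoisson.isLocalQuasiPoisson id)
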